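/- **Definitions.** Let $\Gamma$ be a group. A $\Gamma$-gain graph $(G,\psi)$ is a graph $G$ with a function $\psi$ assigning an element of $\Gamma$ to every oriented edge $(e,u,v)$ such that $\psi(e,v,u)=\psi(e,u,v)^{-1}$ when $u\neq v$. A cycle is *$\psi$-balanced* if the product of the gains along some simple closed walk around it is $1$, and *unbalanced* otherwise. The *frame matroid* $F(G,\psi)$ is the matroid on $E(G)$ whose circuits are the balanced cycles, the theta graphs with all cycles unbalanced, and the tight and loose handcuffs with both cycles unbalanced. For a normal subgroup $\Gamma_1$, $\psi/\Gamma_1$ is the composition of $\psi$ with $\Gamma\to\Gamma/\Gamma_1$. For a function $\eta:V(G)\to\Gamma$ let $\psi^\eta(e,u,v)=\eta(u)^{-1}\psi(e,u,v)\eta(v)$. For finite $\Gamma$, $K_n^\Gamma$ has vertices $v_1,\dots,v_n$ and, for each $i<j$ and each $\alpha\in\Gamma$, one edge between $v_i$ and $v_j$ with $\psi_n^\Gamma$-value $\alpha$ in the direction from $v_i$ to $v_j$. A matroid $M$ is an *elementary lift* of a matroid $N$ if there is a matroid $K$ with an element $e$ such that $K\setminus e=M$ and $K/e=N$. A set $\mathcal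 C$ of circuits of $N$ is a *linear class* if, whenever $C_1,C_2\in\mathcal C$ and $|C_1\cup C_2|-r_N(C_1\cup C_2)=2$, every circuit of $N$ contained in $C_1\cup C_2$ is in $\mathcal C$; the elementary lift of $N$ given by $\mathcal C$ is the matroid in which the rank of $X$ is $r_N(X)$ if every circuit of $N$ contained in $X$ is in $\mathcal C$, and $r_N(X)+1$ otherwise. A subgroup $A$ of $\Gamma$ is *malnormal* if $g^{-1}Ag\cap A=\{1\}$ for all $g\in\Gamma\setminus A$. For a normal subgroup $\Gamma_1$ and a (possibly empty) set $\mathcal A$ of nontrivial subgroups, $\{\Gamma_1\}\cup\mathcal A$ is a *Frobenius partition* of $\Gamma$ if every non-identity element of $\Gamma$ is in exactly one group in $\{\Gamma_1\}\cup\mathcal A$, each $A\in\mathcal A$ is malnormal, and every conjugate of each $A\in\mathcal A$ is in $\mathcal A$. In this case $M(\Gamma,\Gamma_1,\mathcal A,G,\psi)$ is the elementary lift of $F(G,\psi/\Gamma_1)$ given by the linear class consisting of those circuits $C$ of $F(G,\psi/\Gamma_1)$ that are $\psi$-balanced cycles, or are theta graphs or handcuffs for which there are $\eta:V(G)\to\Gamma$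 and $A\in\mathcal A$ such that $\psi^\eta$ takes values in $A$ on all orientations of edges of $C$. **Theorem.** Let $\Gamma$ be a finite group, let $\Gamma_1$ be a normal subgroup of $\Gamma$, and let $n\ge 4$. Let $M$ be an elementary lift of the frame matroid $F(K_n^\Gamma,\psi_n^\Gamma/\Gamma_1)$ such that a cycle of $K_n^\Gamma$ is a circuit of $M$ if and only if it is $\psi_n^\Gamma$-balanced. Then there is a Frobenius partition $\{\Gamma_1\}\cup\mathcal A$ of $\Gamma$ such that $M=M(\Gamma,\Gamma_1,\mathcal A,K_n^\Gamma,\psi_n^\Gamma)$. -/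

import Mathlib

namespace GainGraph

/-- A `Γ`-gain function on a graph `G`: a value for every oriented edge `(e, u, v)`, inverted when
a non-loop edge is reversed. Values at triples that are not oriented edges are irrelevant. -/
structure GainFunction {α β : Type*} (G : Graph α β) (Γ : Type*) [Group Γ] where
  /-- the value at the oriented edge `(e, u, v)` -/
  val : β → α → α → Γ
  /-- reversing the orientation inverts the value -/
  val_symm : ∀ e u v, G.IsLink e u v → u ≠ v → val e v u = (val e u v)⁻¹

/-- `IsPath ψ u v P W g`: there is a path from `u` to `v` in `G` with edge set `P` and vertex
set `W`, and the product of the gains of its oriented edges, in order from `u` to `v`, is `g`. -/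
inductive IsPath {α β Γ : Type*} [Group Γ] {G : Graph α β} (ψ : GainFunction G Γ) :
    α → α → Set β → Set α → Γ → Prop
  | nil (u : α) : u ∈ G.vertexSet → IsPath ψ u u ∅ {u} 1
  | cons (e : β) (u v x : α) (P : Set β) (W : Set α) (g : Γ) :
      G.IsLink e u v → IsPath ψ v x P W g → u ∉ W →
      IsPath ψ u x (insert e P) (insert u W) (ψ.val e u v * g)

/-- `IsCycle ψ C W g`: `C` and `W` are the edge set and vertex set of a cycle of `G`, and `g` is
the value of a simple closed walk on this cycle. Such a walk traverses an edge `e` from `u` to `v`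
and then a path from `v` back to `u` that avoids `e`; a loop is a cycle. -/
inductive IsCycle {α β Γ : Type*} [Group Γ] {G : Graph α β} (ψ : GainFunction G Γ) :
    Set β → Set α → Γ → Prop
  | mk (e : β) (u v : α) (P : Set β) (W : Set α) (g : Γ) :
      G.IsLink e u v → IsPath ψ v u P W g → e ∉ P →
      IsCycle ψ (insert e P) W (ψ.val e u v * g)

/-- `C` is the edge set of a cycle on which some simple closed walk has value `1`. -/
def IsBalancedCycle {α β Γ : Type*} [Group Γ] {G : Graph α β} (ψ : GainFunction G Γ)
    (C : Set β) : Prop :=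
  ∃ W, IsCycle ψ C W 1

/-- `C` and `W` are the edge set and vertex set of a cycle that is not balanced. -/
def IsUnbalancedCycle {α β Γ : Type*} [Group Γ] {G : Graph α β} (ψ : GainFunction G Γ)
    (C : Set β) (W : Set α) : Prop :=
  (∃ g, IsCycle ψ C W g) ∧ ¬ IsBalancedCycle ψ C

/-- `X` is the edge set of a theta graph: three paths between the same two distinct vertices,
pairwise without common edges or common internal vertices. -/
def IsTheta {α β Γ : Type*} [Group Γ] {G : Graph α β} (ψ : GainFunction G Γ)
    (X : Set β) : Prop :=
  ∃ u v P₁ P₂ P₃ W₁ W₂ W₃ g₁ g₂ g₃, u ≠ v ∧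
    IsPath ψ u v P₁ W₁ g₁ ∧ IsPath ψ u v P₂ W₂ g₂ ∧ IsPath ψ u v P₃ W₃ g₃ ∧
    Disjoint P₁ P₂ ∧ Disjoint P₁ P₃ ∧ Disjoint P₂ P₃ ∧
    W₁ ∩ W₂ = {u, v} ∧ W₁ ∩ W₃ = {u, v} ∧ W₂ ∩ W₃ = {u, v} ∧
    X = P₁ ∪ P₂ ∪ P₃

/-- `X` is a theta graph in which every cycle is unbalanced. -/
def IsUnbalancedTheta {α β Γ : Type*} [Group Γ] {G : Graph α β} (ψ : GainFunction G Γ)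
    (X : Set β) : Prop :=
  IsTheta ψ X ∧ ∀ C ⊆ X, ¬ IsBalancedCycle ψ C

/-- `X` is a tight handcuff with both cycles unbalanced: the union of two edge-disjoint
unbalanced cycles with exactly one common vertex. -/
def IsUnbalancedTightHandcuff {α β Γ : Type*} [Group Γ] {G : Graph α β}
    (ψ : GainFunction G Γ) (X : Set β) : Prop :=
  ∃ C₁ C₂ W₁ W₂ x, IsUnbalancedCycle ψ C₁ W₁ ∧ IsUnbalancedCycle ψ C₂ W₂ ∧
    Disjoint C₁ C₂ ∧ W₁ ∩ W₂ = {x} ∧ X = C₁ ∪ C₂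

/-- `X` is a loose handcuff with both cycles unbalanced: the union of two vertex-disjoint
unbalanced cycles and a minimal path connecting them (it meets each of them only in an end). -/
def IsUnbalancedLooseHandcuff {α β Γ : Type*} [Group Γ] {G : Graph α β}
    (ψ : GainFunction G Γ) (X : Set β) : Prop :=
  ∃ C₁ C₂ P W₁ W₂ W u v g, IsUnbalancedCycle ψ C₁ W₁ ∧ IsUnbalancedCycle ψ C₂ W₂ ∧
    IsPath ψ u v P W g ∧ W₁ ∩ W₂ = ∅ ∧ W ∩ W₁ = {u} ∧ W ∩ W₂ = {v} ∧ X = C₁ ∪ C₂ ∪ P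

/-- The circuits of the frame matroid of a gain graph. -/
def IsFrameCircuit {α β Γ : Type*} [Group Γ] {G : Graph α β} (ψ : GainFunction G Γ)
    (X : Set β) : Prop :=
  IsBalancedCycle ψ X ∨ IsUnbalancedTheta ψ X ∨ IsUnbalancedTightHandcuff ψ X ∨
    IsUnbalancedLooseHandcuff ψ X

/-! Facts about paths, cycles and walks that show that the circuits above define a matroid. -/

section Path

variable {α β Γ : Type*} [Group Γ] {G : Graph α β} {ψ : GainFunction G Γ}

theorem IsPath.left_mem {u v P W} {g : Γ} (h : IsPath ψ u v P W g) : u ∈ W := by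
  cases h <;> simp

theorem IsPath.right_mem {u v P W} {g : Γ} (h : IsPath ψ u v P W g) : v ∈ W := by
  induction h with
  | nil => simp
  | cons e u v x P W g hl hp hu ih => exact Or.inr ih

theorem IsPath.subset_vertexSet {u v P W} {g : Γ} (h : IsPath ψ u v P W g) :
    W ⊆ G.vertexSet := by
  induction h with
  | nil u hu => simpa using hu
  | cons e u v x P W g hl hp hu ih => exact Set.insert_subset hl.left_mem ih

theorem IsPath.subset_edgeSet {u v P W} {g : Γ} (h : IsPath ψ u v P W g) :
    P ⊆ G.edgeSet := by
  induction h with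
  | nil u hu => simp
  | cons e u v x P W g hl hp hu ih => exact Set.insert_subset hl.edge_mem ih

theorem IsPath.finite {u v P W} {g : Γ} (h : IsPath ψ u v P W g) : P.Finite := by
  induction h with
  | nil u hu => simp
  | cons e u v x P W g hl hp hu ih => exact ih.insert e

theorem IsPath.ends {u v P W} {g : Γ} (h : IsPath ψ u v P W g) {e a b} (he : e ∈ P)
    (hl : G.IsLink e a b) : a ∈ W ∧ b ∈ W ∧ a ≠ b := by
  induction h with
  | nil u hu => simp at he
  | cons e' u v x P W g hl' hp hu ih =>
    rcases he with rfl | he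
    · have hv := hp.left_mem
      rcases hl'.eq_and_eq_or_eq_and_eq hl with ⟨rfl, rfl⟩ | ⟨rfl, rfl⟩
      · exact ⟨by simp, by simp [hv], fun h => hu (h ▸ hv)⟩
      · exact ⟨by simp [hv], by simp, fun h => hu (h ▸ hv)⟩
    · have := ih he
      exact ⟨Or.inr this.1, Or.inr this.2.1, this.2.2⟩

theorem IsPath.exists_link {u v P W} {g : Γ} (h : IsPath ψ u v P W g) {e} (he : e ∈ P) :
    ∃ a b, G.IsLink e a b ∧ a ∈ W ∧ b ∈ W ∧ a ≠ b := by
  obtain ⟨a, b, hl⟩ := Graph.exists_isLink_of_mem_edgeSet (h.subset_edgeSet he)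
  exact ⟨a, b, hl, h.ends he hl⟩

theorem IsPath.disjoint {u v P W u' v' P' W'} {g g' : Γ} (h : IsPath ψ u v P W g)
    (h' : IsPath ψ u' v' P' W' g') {z : α} (hz : ∀ y ∈ W, y ∈ W' → y = z) : Disjoint P P' := by
  rw [Set.disjoint_left]
  intro e he he'
  obtain ⟨a, b, hl, ha, hb, hab⟩ := h.exists_link he
  have := h'.ends he' hl
  exact hab ((hz a ha this.1).trans (hz b hb this.2.1).symm)

theorem IsPath.append {u v x P W P' W'} {g g' : Γ} (h : IsPath ψ u v P W g)
    (h' : IsPath ψ v x P' W' g') (hz : ∀ y ∈ W, y ∈ W' → y = v) :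
    IsPath ψ u x (P ∪ P') (W ∪ W') (g * g') := by
  induction h with
  | nil u hu =>
    have : ({u} : Set α) ∪ W' = W' := Set.union_eq_right.2 (by simpa using h'.left_mem)
    simpa [this] using h'
  | cons e u w v P W g hl hp hu ih =>
    have := IsPath.cons e u w x _ _ _ hl (ih h' fun y hy hy' => hz y (Or.inr hy) hy') (by
      rintro (h | h)
      · exact hu h
      · exact hu (hz u (by simp) h ▸ hp.right_mem))
    simpa [Set.insert_union, mul_assoc] using this

theorem IsPath.single {e u v} (hl : G.IsLink e u v) (huv : u ≠ v) :
    IsPath ψ u v {e} {u, v} (ψ.val e u v) := by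
  have := IsPath.cons (ψ := ψ) e u v v _ _ _ hl (IsPath.nil v hl.right_mem) (by simpa using huv)
  simpa using this

theorem IsPath.reverse {u v P W} {g : Γ} (h : IsPath ψ u v P W g) :
    IsPath ψ v u P W g⁻¹ := by
  induction h with
  | nil u hu => simpa using IsPath.nil u hu
  | cons e u v x P W g hl hp hu ih =>
    have huv : u ≠ v := fun h => hu (h ▸ hp.left_mem)
    have := ih.append (IsPath.single (ψ := ψ) hl.symm huv.symm) (by
      rintro y hy (rfl | rfl)
      · rfl
      · exact absurd hy hu)
    have h1 : W ∪ {v, u} = insert u W := by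
      have := hp.left_mem
      ext y; simp only [Set.mem_union, Set.mem_insert_iff, Set.mem_singleton_iff]; grind
    rw [h1, Set.union_singleton, ψ.val_symm e u v hl huv, ← mul_inv_rev] at this
    exact this

theorem IsPath.split {u x P W} {g : Γ} (h : IsPath ψ u x P W g) {z} (hz : z ∈ W) :
    ∃ P₁ W₁ g₁ P₂ W₂ g₂, IsPath ψ u z P₁ W₁ g₁ ∧ IsPath ψ z x P₂ W₂ g₂ ∧ P = P₁ ∪ P₂ ∧
      W = W₁ ∪ W₂ ∧ (∀ y ∈ W₁, y ∈ W₂ → y = z) ∧ g = g₁ * g₂ := by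
  induction h with
  | nil u hu =>
    obtain rfl : z = u := hz
    exact ⟨∅, {z}, 1, ∅, {z}, 1, .nil z hu, .nil z hu, by simp, by simp, by simp, by simp⟩
  | cons e u v x P W g hl hp hu ih =>
    by_cases hzu : z = u
    · subst hzu
      exact ⟨∅, {z}, 1, _, _, _, .nil z hl.left_mem, .cons e z v x P W g hl hp hu, by simp,
        by simp, by simp, by simp⟩
    · obtain ⟨P₁, W₁, g₁, P₂, W₂, g₂, h₁, h₂, rfl, rfl, h5, rfl⟩ :=
        ih (hz.resolve_left hzu)
      refine ⟨_, _, _, P₂, W₂, g₂, .cons e u v z P₁ W₁ g₁ hl h₁ fun h => hu (Or.inl h), h₂,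
        by rw [Set.insert_union], by rw [Set.insert_union], ?_, by rw [mul_assoc]⟩
      rintro y (rfl | hy) hy'
      · exact absurd (Or.inr hy') hu
      · exact h5 y hy hy'

theorem IsPath.firstHit {u x P W} {g : Γ} (h : IsPath ψ u x P W g) {S : Set α} (hx : x ∈ S) :
    ∃ z P₁ W₁ g₁, IsPath ψ u z P₁ W₁ g₁ ∧ P₁ ⊆ P ∧ W₁ ⊆ W ∧ z ∈ S ∧ ∀ y ∈ W₁, y ∈ S → y = z := by
  induction h with
  | nil u hu => exact ⟨u, _, _, _, .nil u hu, subset_rfl, subset_rfl, hx, by simp⟩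
  | cons e u v x P W g hl hp hu ih =>
    by_cases huS : u ∈ S
    · exact ⟨u, _, _, _, .nil u hl.left_mem, by simp, by simp, huS, by simp⟩
    · obtain ⟨z, P₁, W₁, g₁, h1, h2, h3, h4, h5⟩ := ih hx
      refine ⟨z, _, _, _, .cons e u v z _ _ _ hl h1 (fun h => hu (h3 h)),
        Set.insert_subset_insert h2, Set.insert_subset_insert h3, h4, ?_⟩
      rintro y (rfl | hy) hy'
      · exact absurd hy' huS
      · exact h5 y hy hy'

theorem IsPath.eq_nil {u P W} {g : Γ} (h : IsPath ψ u u P W g) : P = ∅ ∧ W = {u} ∧ g = 1 := by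
  cases h with
  | nil => simp
  | cons e u v x P W g hl hp hu => exact absurd hp.right_mem hu

theorem IsPath.gain_of_mem {v u P W} {g : Γ} (h : IsPath ψ v u P W g) {e} (he : e ∈ P)
    (hl : G.IsLink e v u) : g = ψ.val e v u := by
  cases h with
  | nil => simp at he
  | cons e' v w x P W g hl' hp hu =>
    rcases he with rfl | he
    · obtain rfl := hl.right_unique hl'
      rw [hp.eq_nil.2.2, mul_one]
    · exact absurd (hp.ends he hl).1 hu

theorem IsCycle.finite {C W} {g : Γ} (h : IsCycle ψ C W g) : C.Finite := by
  cases h with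
  | mk e u v P _ g hl hp he => exact hp.finite.insert e

theorem IsCycle.nonempty {C W} {g : Γ} (h : IsCycle ψ C W g) : C.Nonempty := by
  cases h with
  | mk e u v P _ g hl hp he => exact ⟨e, by simp⟩

theorem IsCycle.subset_vertexSet {C W} {g : Γ} (h : IsCycle ψ C W g) : W ⊆ G.vertexSet := by
  cases h with
  | mk e u v P _ g hl hp he => exact hp.subset_vertexSet

theorem IsCycle.ends {C W} {g : Γ} (h : IsCycle ψ C W g) {e a b} (he : e ∈ C)
    (hl : G.IsLink e a b) : a ∈ W ∧ b ∈ W := by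
  cases h with
  | mk e' u v P _ g hl' hp he' =>
    rcases he with rfl | he
    · have h1 := hp.left_mem
      have h2 := hp.right_mem
      rcases hl'.eq_and_eq_or_eq_and_eq hl with ⟨rfl, rfl⟩ | ⟨rfl, rfl⟩ <;> simp [h1, h2]
    · exact ⟨(hp.ends he hl).1, (hp.ends he hl).2.1⟩

/-- A cycle is the union of two internally disjoint paths between any two of its vertices. -/
theorem IsCycle.arcs {C W} {g : Γ} (h : IsCycle ψ C W g) {s t} (hs : s ∈ W) (ht : t ∈ W)
    (hst : s ≠ t) :
    ∃ P₁ W₁ g₁ P₂ W₂ g₂, IsPath ψ s t P₁ W₁ g₁ ∧ IsPath ψ s t P₂ W₂ g₂ ∧ Disjoint P₁ P₂ ∧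
      W₁ ∩ W₂ = {s, t} ∧ C = P₁ ∪ P₂ ∧ W = W₁ ∪ W₂ := by
  cases h with
  | mk e u v P _ g hl hp he =>
    have huv : u ≠ v := by
      rintro rfl
      have := hp.eq_nil.2.1
      subst this
      exact hst (hs.trans ht.symm)
    -- the case in which `s` comes before `t` on the path from `v` to `u`
    have key : ∀ s t, s ∈ W → t ∈ W → s ≠ t →
        ∀ {A WA a Q WQ q}, IsPath ψ v s A WA a → IsPath ψ s u Q WQ q → P = A ∪ Q →
        W = WA ∪ WQ → (∀ y ∈ WA, y ∈ WQ → y = s) → t ∈ WQ →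
        ∃ P₁ W₁ g₁ P₂ W₂ g₂, IsPath ψ s t P₁ W₁ g₁ ∧ IsPath ψ s t P₂ W₂ g₂ ∧ Disjoint P₁ P₂ ∧
          W₁ ∩ W₂ = {s, t} ∧ insert e P = P₁ ∪ P₂ ∧ W = W₁ ∪ W₂ := by
      intro s t hs ht hst A WA a Q WQ q hA hQ hP hW hAQ htQ
      obtain ⟨M, WM, m, B, WB, b, hM, hB, rfl, rfl, hMB, rfl⟩ := hQ.split htQ
      have hAB : ∀ y ∈ WA, y ∉ WB := by
        intro y h1 h2
        have := hAQ y h1 (Or.inr h2)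
        subst this
        exact hst (hMB y hM.left_mem h2)
      have hvB : v ∉ WB := hAB v hA.left_mem
      have huA : u ∉ WA := fun h => hAB u h hB.right_mem
      have h1 := (IsPath.single (ψ := ψ) hl huv).append hA.reverse.reverse (by
        rintro y (rfl | rfl) hy
        · exact absurd hy huA
        · rfl)
      have h2 := (hB.append h1 (by
        rintro y hy ((rfl | rfl) | hy')
        · rfl
        · exact absurd hy hvB
        · exact absurd hy (hAB y hy'))).reverse
      refine ⟨_, _, _, _, _, _, hM, h2, ?_, ?_, ?_, ?_⟩
      · have d1 := hM.disjoint hB hMB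
        have d2 : Disjoint M A := hM.disjoint hA (z := s) fun y h1 h2 => hAQ y h2 (Or.inl h1)
        have d3 : e ∉ M := fun h => he (hP ▸ Or.inr (Or.inl h))
        simp [d1, d2, d3]
      · have := hM.left_mem
        have := hM.right_mem
        have := hB.left_mem
        have := hA.right_mem
        have := hB.right_mem
        have := hA.left_mem
        ext y
        simp only [Set.mem_inter_iff, Set.mem_union, Set.mem_insert_iff, Set.mem_singleton_iff]
        simp only [Set.mem_union] at hAQ
        grind
      · rw [hP]; ext y
        simp only [Set.mem_union, Set.mem_insert_iff, Set.mem_singleton_iff]; tauto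
      · rw [hW]
        have := hB.right_mem
        have := hA.left_mem
        ext y
        simp only [Set.mem_union, Set.mem_insert_iff, Set.mem_singleton_iff]
        grind
    obtain ⟨A, WA, a, Q, WQ, q, hA, hQ, hP, hW, hAQ, -⟩ := hp.split hs
    by_cases htQ : t ∈ WQ
    · exact key s t hs ht hst hA hQ hP hW hAQ htQ
    · have htA : t ∈ WA := by rw [hW] at ht; exact ht.resolve_right htQ
      obtain ⟨A₁, WA₁, a₁, A₂, WA₂, a₂, hA₁, hA₂, rfl, rfl, hAA, -⟩ := hA.split htA
      have hQ' := hA₂.append hQ fun y h1 h2 => hAQ y (Or.inr h1) h2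
      obtain ⟨P₁, W₁, g₁, P₂, W₂, g₂, h1, h2, h3, h4, h5, h6⟩ :=
        key t s ht hs hst.symm hA₁ hQ' (by rw [hP, Set.union_assoc])
          (by rw [hW, Set.union_assoc]) (by
            rintro y hy (hy' | hy')
            · exact hAA y hy hy'
            · have := hAQ y (Or.inl hy) hy'
              subst this
              exact hAA y hy hA₂.right_mem) (Or.inl hA₂.right_mem)
      exact ⟨P₁, W₁, _, P₂, W₂, _, h1.reverse, h2.reverse, h3, by rw [h4, Set.pair_comm], h5, h6⟩

end Path

section Closure

variable {α β Γ : Type*} [Group Γ] {G : Graph α β} {ψ : GainFunction G Γ}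

/-- `Reach ψ X u v g`: the gain `g` is the value of a walk from `u` to `v` using edges of `X`,
where a loop may also be traversed backwards. -/
inductive Reach (ψ : GainFunction G Γ) (X : Set β) : α → α → Γ → Prop
  | nil (u : α) : Reach ψ X u u 1
  | cons (e : β) (u v x : α) (g : Γ) : e ∈ X → G.IsLink e u v → Reach ψ X v x g →
      Reach ψ X u x (ψ.val e u v * g)
  | consInv (e : β) (u v x : α) (g : Γ) : e ∈ X → G.IsLink e u v → Reach ψ X v x g →
      Reach ψ X u x ((ψ.val e v u)⁻¹ * g)

/-- The component of `u` in the graph with edge set `X` is unbalanced. -/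
def Unb (ψ : GainFunction G Γ) (X : Set β) (u : α) : Prop := ∃ g, g ≠ 1 ∧ Reach ψ X u u g

/-- Adding an oriented edge from `u` to `v` with gain `g` to `X` does not increase the rank. -/
def Spanned (ψ : GainFunction G Γ) (X : Set β) (u v : α) (g : Γ) : Prop :=
  Reach ψ X u v g ∨ (Unb ψ X u ∧ Unb ψ X v)

/-- The closure operator of the frame matroid. -/
def frameClosure (ψ : GainFunction G Γ) (X : Set β) : Set β :=
  {e | ∃ u v, G.IsLink e u v ∧ Spanned ψ X u v (ψ.val e u v)}

theorem Reach.mono {X Y : Set β} (hXY : X ⊆ Y) {u v} {g : Γ} (h : Reach ψ X u v g) :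
    Reach ψ Y u v g := by
  induction h with
  | nil u => exact .nil u
  | cons e u v x g he hl _ ih => exact .cons e u v x g (hXY he) hl ih
  | consInv e u v x g he hl _ ih => exact .consInv e u v x g (hXY he) hl ih

theorem Reach.trans {X : Set β} {u v x} {g k : Γ} (h : Reach ψ X u v g) (h' : Reach ψ X v x k) :
    Reach ψ X u x (g * k) := by
  induction h with
  | nil u => simpa using h'
  | cons e u v x g he hl _ ih => rw [mul_assoc]; exact .cons e u v _ _ he hl (ih h')
  | consInv e u v x g he hl _ ih => rw [mul_assoc]; exact .consInv e u v _ _ he hl (ih h')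

theorem Reach.single {X : Set β} {e u v} (he : e ∈ X) (hl : G.IsLink e u v) :
    Reach ψ X u v (ψ.val e u v) := by
  simpa using Reach.cons (ψ := ψ) e u v v _ he hl (.nil v)

theorem Reach.symm {X : Set β} {u v} {g : Γ} (h : Reach ψ X u v g) : Reach ψ X v u g⁻¹ := by
  induction h with
  | nil u => simpa using Reach.nil (ψ := ψ) u
  | cons e u v x g he hl _ ih =>
    rw [mul_inv_rev]
    exact ih.trans (by simpa using Reach.consInv (ψ := ψ) e v u u _ he hl.symm (.nil u))
  | consInv e u v x g he hl _ ih =>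
    rw [mul_inv_rev, inv_inv]
    exact ih.trans (.single he hl.symm)

theorem Unb.mono {X Y : Set β} (hXY : X ⊆ Y) {u} (h : Unb ψ X u) : Unb ψ Y u :=
  h.imp fun _ h => ⟨h.1, h.2.mono hXY⟩

theorem Unb.trans {X : Set β} {u v} {g : Γ} (h : Unb ψ X u) (h' : Reach ψ X u v g) :
    Unb ψ X v := by
  obtain ⟨k, hk, h⟩ := h
  refine ⟨g⁻¹ * k * g, fun h0 => hk ?_, (h'.symm.trans h).trans h'⟩
  have : k = g * (g⁻¹ * k * g) * g⁻¹ := by group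
  rw [this, h0]; group

theorem Unb.of_ne {X : Set β} {u v} {g k : Γ} (h : Reach ψ X u v g) (h' : Reach ψ X u v k)
    (hgk : g ≠ k) : Unb ψ X u :=
  ⟨g * k⁻¹, fun h0 => hgk (mul_inv_eq_one.1 h0), h.trans h'.symm⟩

theorem Spanned.mono {X Y : Set β} (hXY : X ⊆ Y) {u v} {g : Γ} (h : Spanned ψ X u v g) :
    Spanned ψ Y u v g :=
  h.imp (fun h => h.mono hXY) fun h => ⟨h.1.mono hXY, h.2.mono hXY⟩

theorem Spanned.symm {X : Set β} {u v} {g : Γ} (h : Spanned ψ X u v g) :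
    Spanned ψ X v u g⁻¹ :=
  h.imp (fun h => h.symm) fun h => ⟨h.2, h.1⟩

theorem Spanned.trans {X : Set β} {u v x} {g k : Γ} (h : Spanned ψ X u v g)
    (h' : Spanned ψ X v x k) : Spanned ψ X u x (g * k) := by
  rcases h with h | h <;> rcases h' with h' | h'
  · exact Or.inl (h.trans h')
  · exact Or.inr ⟨h'.1.trans h.symm, h'.2⟩
  · exact Or.inr ⟨h.1, h.2.trans h'⟩
  · exact Or.inr ⟨h.1, h'.2⟩

theorem Spanned.unb {X : Set β} {u} {g : Γ} (h : Spanned ψ X u u g) (hg : g ≠ 1) : Unb ψ X u :=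
  h.elim (fun h => ⟨g, hg, h⟩) fun h => h.1

theorem spanned_of_mem_closure {X : Set β} {e u v} (he : e ∈ frameClosure ψ X)
    (hl : G.IsLink e u v) : Spanned ψ X u v (ψ.val e u v) := by
  obtain ⟨a, b, hl', h⟩ := he
  rcases hl.eq_and_eq_or_eq_and_eq hl' with ⟨rfl, rfl⟩ | ⟨rfl, rfl⟩
  · exact h
  · by_cases huv : u = v
    · subst huv; exact h
    · rw [ψ.val_symm _ _ _ hl' (Ne.symm huv)]; exact h.symm

theorem subset_frameClosure {X : Set β} (hX : X ⊆ G.edgeSet) : X ⊆ frameClosure ψ X := by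
  intro e he
  obtain ⟨u, v, hl⟩ := Graph.exists_isLink_of_mem_edgeSet (hX he)
  exact ⟨u, v, hl, Or.inl (.single he hl)⟩

theorem frameClosure_mono {X Y : Set β} (hXY : X ⊆ Y) :
    frameClosure ψ X ⊆ frameClosure ψ Y :=
  fun _ ⟨u, v, hl, h⟩ => ⟨u, v, hl, h.mono hXY⟩

theorem Reach.of_closure {X Y : Set β} (hY : Y ⊆ frameClosure ψ X) {u v} {g : Γ}
    (h : Reach ψ Y u v g) : Spanned ψ X u v g := by
  induction h with
  | nil u => exact Or.inl (.nil u)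
  | cons e u v x g he hl _ ih => exact (spanned_of_mem_closure (hY he) hl).trans ih
  | consInv e u v x g he hl _ ih =>
    exact (spanned_of_mem_closure (hY he) hl.symm).symm.trans ih

theorem Unb.of_closure {X Y : Set β} (hY : Y ⊆ frameClosure ψ X) {u} (h : Unb ψ Y u) :
    Unb ψ X u := by
  obtain ⟨g, hg, h⟩ := h
  exact (h.of_closure hY).unb hg

theorem frameClosure_idem {X Y : Set β} (hY : Y ⊆ frameClosure ψ X) :
    frameClosure ψ Y ⊆ frameClosure ψ X := by
  rintro e ⟨u, v, hl, h | h⟩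
  · exact ⟨u, v, hl, h.of_closure hY⟩
  · exact ⟨u, v, hl, Or.inr ⟨h.1.of_closure hY, h.2.of_closure hY⟩⟩

/-- `x` is joined by a walk in `X` to `u` or to `v`. -/
def Near (ψ : GainFunction G Γ) (X : Set β) (u v x : α) : Prop :=
  (∃ g, Reach ψ X x u g) ∨ ∃ g, Reach ψ X x v g

/-- The effect of adding to `X` an edge with ends `u`, `v` and gain `a`. -/
def Added (ψ : GainFunction G Γ) (X : Set β) (u v : α) (a : Γ) (x y : α) (g : Γ) : Prop :=
  Reach ψ X x y g ∨
  (∃ h k, Reach ψ X x u h ∧ Reach ψ X v y k ∧ g = h * a * k) ∨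
  (∃ h k, Reach ψ X x v h ∧ Reach ψ X u y k ∧ g = h * a⁻¹ * k) ∨
  ((Unb ψ X u ∨ Unb ψ X v ∨ ∃ k, Reach ψ X u v k) ∧ Near ψ X u v x ∧ Near ψ X u v y)

theorem Near.of_reach {X : Set β} {u v x y} {g : Γ} (h : Reach ψ X x y g)
    (hy : Near ψ X u v y) : Near ψ X u v x :=
  hy.imp (fun ⟨_, hk⟩ => ⟨_, h.trans hk⟩) fun ⟨_, hk⟩ => ⟨_, h.trans hk⟩

theorem Added.swap {X : Set β} {u v x y} {a g : Γ} (h : Added ψ X u v a x y g) :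
    Added ψ X v u a⁻¹ x y g := by
  rcases h with h | h | h | ⟨h1, h2, h3⟩
  · exact Or.inl h
  · exact Or.inr (Or.inr (Or.inl (by simpa using h)))
  · exact Or.inr (Or.inl h)
  · refine Or.inr (Or.inr (Or.inr ⟨?_, Or.symm h2, Or.symm h3⟩))
    rcases h1 with h1 | h1 | ⟨k, h1⟩
    · exact Or.inr (Or.inl h1)
    · exact Or.inl h1
    · exact Or.inr (Or.inr ⟨_, h1.symm⟩)

theorem Added.reach_left {X : Set β} {u v w x y} {a g k : Γ} (h' : Reach ψ X w x k)
    (h : Added ψ X u v a x y g) : Added ψ X u v a w y (k * g) := by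
  rcases h with h | ⟨p, q, h1, h2, rfl⟩ | ⟨p, q, h1, h2, rfl⟩ | ⟨h1, h2, h3⟩
  · exact Or.inl (h'.trans h)
  · exact Or.inr (Or.inl ⟨_, _, h'.trans h1, h2, by group⟩)
  · exact Or.inr (Or.inr (Or.inl ⟨_, _, h'.trans h1, h2, by group⟩))
  · exact Or.inr (Or.inr (Or.inr ⟨h1, h2.of_reach h', h3⟩))

theorem Added.step {X : Set β} {u v y} {a g : Γ} (h : Added ψ X u v a v y g) :
    Added ψ X u v a u y (a * g) := by
  have hu : Near ψ X u v u := Or.inl ⟨_, .nil u⟩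
  rcases h with h | ⟨p, q, h1, h2, rfl⟩ | ⟨p, q, h1, h2, rfl⟩ | ⟨h1, h2, h3⟩
  · exact Or.inr (Or.inl ⟨1, g, .nil u, h, by group⟩)
  · exact Or.inr (Or.inr (Or.inr ⟨Or.inr (Or.inr ⟨_, h1.symm⟩), hu, Or.inr ⟨_, h2.symm⟩⟩))
  · by_cases hp : p = 1
    · subst hp
      left
      have : a * (1 * a⁻¹ * q) = q := by group
      rw [this]; exact h2
    · exact Or.inr (Or.inr (Or.inr ⟨Or.inr (Or.inl ⟨p, hp, h1⟩), hu, Or.inl ⟨_, h2.symm⟩⟩))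
  · exact Or.inr (Or.inr (Or.inr ⟨h1, hu, h3⟩))

theorem Reach.added {X : Set β} {e u v x y} {g : Γ} (hl : G.IsLink e u v)
    (h : Reach ψ (insert e X) x y g) : Added ψ X u v (ψ.val e u v) x y g := by
  have back : ∀ {y g}, Added ψ X u v (ψ.val e u v) u y g →
      Added ψ X u v (ψ.val e u v) v y ((ψ.val e u v)⁻¹ * g) := by
    intro y g h
    simpa using h.swap.step.swap
  induction h with
  | nil x => exact Or.inl (.nil x)
  | cons e' x z y g he' hl' _ ih =>
    rcases he' with rfl | he'
    · rcases hl'.eq_and_eq_or_eq_and_eq hl with ⟨rfl, rfl⟩ | ⟨rfl, rfl⟩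
      · exact ih.step
      · by_cases hxz : x = z
        · subst hxz; exact ih.step
        · rw [ψ.val_symm _ _ _ hl (Ne.symm hxz)]; exact back ih
    · exact ih.reach_left (.single he' hl')
  | consInv e' x z y g he' hl' _ ih =>
    rcases he' with rfl | he'
    · rcases hl'.eq_and_eq_or_eq_and_eq hl with ⟨rfl, rfl⟩ | ⟨rfl, rfl⟩
      · by_cases hxz : x = z
        · subst hxz; exact back ih
        · rw [ψ.val_symm _ _ _ hl hxz, inv_inv]; exact ih.step
      · exact back ih
    · exact ih.reach_left (Reach.single he' hl'.symm).symm

theorem Unb.added {X : Set β} {e u v x} (hl : G.IsLink e u v)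
    (h : Unb ψ (insert e X) x) : Unb ψ X x ∨
      ((Unb ψ X u ∨ Unb ψ X v ∨ ∃ k, Reach ψ X u v k) ∧ Near ψ X u v x) := by
  obtain ⟨g, hg, h⟩ := h
  rcases h.added hl with h | ⟨p, q, h1, h2, rfl⟩ | ⟨p, q, h1, h2, rfl⟩ | ⟨h1, h2, h3⟩
  · exact Or.inl ⟨g, hg, h⟩
  · exact Or.inr ⟨Or.inr (Or.inr ⟨_, (h2.trans h1).symm⟩), Or.inl ⟨_, h1⟩⟩
  · exact Or.inr ⟨Or.inr (Or.inr ⟨_, h2.trans h1⟩), Or.inr ⟨_, h1⟩⟩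
  · exact Or.inr ⟨h1, h2⟩

/-- The mixed case of the exchange property. -/
theorem exchange_aux {X : Set β} {u v p q} {f : β} (hl : G.IsLink f p q)
    (hf : ¬ Spanned ψ X p q (ψ.val f p q))
    (hQ : Unb ψ X u ∨ Unb ψ X v ∨ ∃ k, Reach ψ X u v k)
    (hp : Near ψ X u v p) (hq : Near ψ X u v q) :
    Unb ψ (insert f X) u ∧ Unb ψ (insert f X) v := by
  have hX : X ⊆ insert f X := Set.subset_insert f X
  have hpq : Reach ψ (insert f X) p q (ψ.val f p q) := .single (by simp) hl
  -- if `p` and `q` are joined in `X`, then adding `f` unbalances them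
  have hU : ∀ k, Reach ψ X p q k → Unb ψ (insert f X) p := by
    intro k hk
    refine Unb.of_ne hpq (hk.mono hX) ?_
    rintro rfl
    exact hf (Or.inl hk)
  have main : ∀ u v, Unb ψ X u → Near ψ X u v p → Near ψ X u v q →
      Unb ψ (insert f X) u ∧ Unb ψ (insert f X) v := by
    rintro u v hu (⟨a, ha⟩ | ⟨a, ha⟩) (⟨b, hb⟩ | ⟨b, hb⟩)
    · exact absurd (Or.inr ⟨hu.trans ha.symm, hu.trans hb.symm⟩) hf
    · exact ⟨hu.mono hX, (hu.mono hX).trans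
        (((ha.symm.mono hX).trans hpq).trans (hb.mono hX))⟩
    · exact ⟨hu.mono hX, (hu.mono hX).trans
        (((hb.symm.mono hX).trans hpq.symm).trans (ha.mono hX))⟩
    · exact ⟨hu.mono hX, (hU _ (ha.trans hb.symm)).trans (ha.mono hX)⟩
  rcases hQ with hu | hv | ⟨k, hk⟩
  · exact main u v hu hp hq
  · exact (main v u hv hp.symm hq.symm).symm
  · obtain ⟨a, ha⟩ : ∃ a, Reach ψ X p u a := by
      rcases hp with h | ⟨a, ha⟩
      · exact h
      · exact ⟨_, ha.trans hk.symm⟩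
    obtain ⟨b, hb⟩ : ∃ b, Reach ψ X q u b := by
      rcases hq with h | ⟨a, ha⟩
      · exact h
      · exact ⟨_, ha.trans hk.symm⟩
    have := (hU _ (ha.trans hb.symm)).trans (ha.mono hX)
    exact ⟨this, this.trans (hk.mono hX)⟩

theorem frameClosure_exchange {X : Set β} {e f} (he : e ∈ G.edgeSet)
    (h : f ∈ frameClosure ψ (insert e X)) (hf : f ∉ frameClosure ψ X) :
    e ∈ frameClosure ψ (insert f X) := by
  obtain ⟨u, v, hl⟩ := Graph.exists_isLink_of_mem_edgeSet he
  obtain ⟨p, q, hl', h⟩ := h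
  have hf' : ¬ Spanned ψ X p q (ψ.val f p q) := fun h => hf ⟨p, q, hl', h⟩
  have hX : X ⊆ insert f X := Set.subset_insert f X
  have hpq : Reach ψ (insert f X) p q (ψ.val f p q) := .single (by simp) hl'
  refine ⟨u, v, hl, ?_⟩
  rcases h with h | ⟨h1, h2⟩
  · rcases h.added hl with h | ⟨c, d, h1, h2, h3⟩ | ⟨c, d, h1, h2, h3⟩ | ⟨h1, h2, h3⟩
    · exact absurd (Or.inl h) hf'
    · left
      have := (h1.symm.mono hX).trans (hpq.trans (h2.symm.mono hX))
      rw [h3] at this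
      convert this using 1; group
    · left
      have := (h2.mono hX).trans (hpq.symm.trans (h1.mono hX))
      rw [h3] at this
      convert this using 1; group
    · exact Or.inr (exchange_aux hl' hf' h1 h2 h3)
  · -- both ends of `f` become unbalanced after adding `e`
    have key : ∀ p q, Unb ψ X q → ¬ Unb ψ X p →
        (∃ r, Reach ψ (insert f X) q p r) →
        (Unb ψ X u ∨ Unb ψ X v ∨ ∃ k, Reach ψ X u v k) → Near ψ X u v p →
        Unb ψ (insert f X) u ∧ Unb ψ (insert f X) v := by
      intro p q hq hp hr hQ hnear
      obtain ⟨r, hr⟩ := hr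
      have hp' : Unb ψ (insert f X) p := (hq.mono hX).trans hr
      rcases hQ with hu | hv | ⟨k, hk⟩
      · rcases hnear with ⟨a, ha⟩ | ⟨a, ha⟩
        · exact absurd (hu.trans ha.symm) hp
        · exact ⟨hu.mono hX, hp'.trans (ha.mono hX)⟩
      · rcases hnear with ⟨a, ha⟩ | ⟨a, ha⟩
        · exact ⟨hp'.trans (ha.mono hX), hv.mono hX⟩
        · exact absurd (hv.trans ha.symm) hp
      · rcases hnear with ⟨a, ha⟩ | ⟨a, ha⟩
        · have := hp'.trans (ha.mono hX)
          exact ⟨this, this.trans (hk.mono hX)⟩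
        · have := hp'.trans (ha.mono hX)
          exact ⟨this.trans (hk.symm.mono hX), this⟩
    right
    by_cases hp : Unb ψ X p <;> by_cases hq : Unb ψ X q
    · exact absurd (Or.inr ⟨hp, hq⟩) hf'
    · obtain ⟨hQ, hn⟩ := (h2.added hl).resolve_left hq
      exact key q p hp hq ⟨_, hpq⟩ hQ hn
    · obtain ⟨hQ, hn⟩ := (h1.added hl).resolve_left hp
      exact key p q hq hp ⟨_, hpq.symm⟩ hQ hn
    · obtain ⟨hQ, hn⟩ := (h1.added hl).resolve_left hp
      obtain ⟨-, hn'⟩ := (h2.added hl).resolve_left hq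
      exact exchange_aux hl' hf' hQ hn hn'

theorem IsPath.reach {X : Set β} {u v P W} {g : Γ} (h : IsPath ψ u v P W g) (hP : P ⊆ X) :
    Reach ψ X u v g := by
  induction h with
  | nil u hu => exact .nil u
  | cons e u v x P W g hl hp hu ih =>
    exact .cons e u v x g (hP (by simp)) hl (ih ((Set.subset_insert _ _).trans hP))

theorem IsPath.reach_mem {X : Set β} {u v P W} {g : Γ} (h : IsPath ψ u v P W g) (hP : P ⊆ X)
    {y} (hy : y ∈ W) : ∃ k, Reach ψ X u y k := by
  obtain ⟨P₁, W₁, g₁, P₂, W₂, g₂, h1, h2, rfl, -⟩ := h.split hy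
  exact ⟨_, h1.reach (Set.subset_union_left.trans hP)⟩

theorem IsCycle.reach_mem {X : Set β} {C W} {g : Γ} (h : IsCycle ψ C W g) (hC : C ⊆ X)
    {x y} (hx : x ∈ W) (hy : y ∈ W) : ∃ k, Reach ψ X x y k := by
  cases h with
  | mk e u v P _ g hl hp he =>
    have hP : P ⊆ X := (Set.subset_insert _ _).trans hC
    obtain ⟨a, ha⟩ := hp.reach_mem hP hx
    obtain ⟨b, hb⟩ := hp.reach_mem hP hy
    exact ⟨_, ha.symm.trans hb⟩

theorem IsCycle.unb {X : Set β} {C W} {g : Γ} (h : IsCycle ψ C W g) (hg : g ≠ 1) (hC : C ⊆ X)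
    {x} (hx : x ∈ W) : Unb ψ X x := by
  obtain ⟨b, hb, hbW⟩ : ∃ b, b ∈ W ∧ Unb ψ X b := by
    cases h with
    | mk e u v P _ g hl hp he =>
      exact ⟨u, hp.right_mem, _, hg, .cons e u v u g (hC (by simp)) hl
        (hp.reach ((Set.subset_insert _ _).trans hC))⟩
  obtain ⟨k, hk⟩ := h.reach_mem hC hb hx
  exact hbW.trans hk

theorem IsUnbalancedCycle.unb {X : Set β} {C W} (h : IsUnbalancedCycle ψ C W) (hC : C ⊆ X)
    {x} (hx : x ∈ W) : Unb ψ X x := by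
  obtain ⟨⟨g, hg⟩, h2⟩ := h
  exact hg.unb (by rintro rfl; exact h2 ⟨W, hg⟩) hC hx

/-- A cycle one of whose vertices is unbalanced outside the cycle has an edge that is spanned
by the other edges. -/
theorem IsCycle.exists_mem_closure {X : Set β} {C W} {g : Γ} (h : IsCycle ψ C W g) {x}
    (hx : x ∈ W) {Y} (hY : Unb ψ Y x) (hCY : Disjoint C Y) (hCX : C ⊆ X) (hYX : Y ⊆ X) :
    ∃ e ∈ C, e ∈ frameClosure ψ (X \ {e}) := by
  cases h with
  | mk e u v P _ g hl hp he =>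
    have hP : P ⊆ X \ {e} := Set.subset_sdiff_singleton
      ((Set.subset_insert _ _).trans hCX) he
    have hY' : Y ⊆ X \ {e} := Set.subset_sdiff_singleton hYX
      (Set.disjoint_left.1 hCY (by simp))
    obtain ⟨a, ha⟩ := hp.reach_mem hP hx
    have hv := (hY.mono hY').trans ha.symm
    exact ⟨e, by simp, u, v, hl, Or.inr ⟨hv.trans (hp.reach hP), hv⟩⟩

/-- Two paths with the same ends and nothing else in common form a cycle. -/
theorem IsPath.isCycle {u v P₁ W₁ P₂ W₂} {g₁ g₂ : Γ} (h₁ : IsPath ψ u v P₁ W₁ g₁)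
    (h₂ : IsPath ψ u v P₂ W₂ g₂) (huv : u ≠ v) (hP : Disjoint P₁ P₂) (hW : W₁ ∩ W₂ = {u, v}) :
    ∃ W, IsCycle ψ (P₁ ∪ P₂) W (g₁ * g₂⁻¹) := by
  cases h₁ with
  | nil => exact absurd rfl huv
  | cons e u w x P W g hl hp hu =>
    have h := hp.append h₂.reverse (by
      intro y hy hy'
      have : y ∈ insert u W ∩ W₂ := ⟨Or.inr hy, hy'⟩
      rw [hW] at this
      rcases this with rfl | h
      · exact absurd hy hu
      · exact h)
    refine ⟨W ∪ W₂, ?_⟩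
    rw [Set.insert_union, mul_assoc]
    refine .mk e u w _ _ _ hl h ?_
    rintro (h | h)
    · exact hu (hp.ends h hl).1
    · exact Set.disjoint_left.1 hP (by simp) h

theorem IsFrameCircuit.exists_mem_closure {C : Set β} (h : IsFrameCircuit ψ C) :
    ∃ e ∈ C, e ∈ frameClosure ψ (C \ {e}) := by
  rcases h with ⟨W, h⟩ | ⟨h, hC⟩ | h | h
  · generalize hk : (1 : Γ) = k at h
    cases h with
    | mk e u v P _ g hl hp he =>
      refine ⟨e, by simp, u, v, hl, Or.inl ?_⟩
      have := (hp.reach (X := insert e P \ {e})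
        (Set.subset_sdiff_singleton (Set.subset_insert _ _) he)).symm
      rwa [← eq_inv_of_mul_eq_one_left hk.symm] at this
  · obtain ⟨u, v, P₁, P₂, P₃, W₁, W₂, W₃, g₁, g₂, g₃, huv, h1, h2, h3, d12, d13, d23, w12, w13,
      w23, rfl⟩ := h
    have hg : g₂ ≠ g₃ := by
      rintro rfl
      obtain ⟨W, hW⟩ := h2.isCycle h3 huv d23 w23
      rw [mul_inv_cancel] at hW
      exact hC _ (by rw [Set.union_assoc]; exact Set.subset_union_right) ⟨W, hW⟩
    cases h1 with
    | nil => exact absurd rfl huv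
    | cons e u w x P W g hl hp hu =>
      have heP : e ∉ P := fun h => hu (hp.ends h hl).1
      have he2 : e ∉ P₂ := Set.disjoint_left.1 d12 (by simp)
      have he3 : e ∉ P₃ := Set.disjoint_left.1 d13 (by simp)
      have h2' := h2.reach (X := (insert e P ∪ P₂ ∪ P₃) \ {e}) (Set.subset_sdiff_singleton
        (Set.subset_union_right.trans Set.subset_union_left) he2)
      have h3' := h3.reach (X := (insert e P ∪ P₂ ∪ P₃) \ {e}) (Set.subset_sdiff_singleton
        Set.subset_union_right he3)
      have h1' := hp.reach (X := (insert e P ∪ P₂ ∪ P₃) \ {e}) (Set.subset_sdiff_singleton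
        ((Set.subset_insert _ _).trans (Set.subset_union_left.trans Set.subset_union_left)) heP)
      have hU := Unb.of_ne h2' h3' hg
      exact ⟨e, by simp, u, w, hl, Or.inr ⟨hU, hU.trans (h2'.trans h1'.symm)⟩⟩
  · obtain ⟨C₁, C₂, W₁, W₂, x, ⟨⟨g, h1⟩, -⟩, h2, hd, hW, rfl⟩ := h
    have hx : x ∈ W₁ ∩ W₂ := by rw [hW]; rfl
    obtain ⟨e, he, h⟩ := h1.exists_mem_closure (X := C₁ ∪ C₂) hx.1 (h2.unb subset_rfl hx.2) hd
      Set.subset_union_left Set.subset_union_right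
    exact ⟨e, Or.inl he, h⟩
  · obtain ⟨C₁, C₂, P, W₁, W₂, W, u, v, k, ⟨⟨g, h1⟩, -⟩, h2, hP, hW, hu, hv, rfl⟩ := h
    have hu' : u ∈ W ∩ W₁ := by rw [hu]; rfl
    have hv' : v ∈ W ∩ W₂ := by rw [hv]; rfl
    have hd : Disjoint C₁ (C₂ ∪ P) := by
      obtain ⟨⟨g', h2'⟩, -⟩ := h2
      rw [Set.disjoint_left]
      rintro e he (he' | he')
      · obtain ⟨a, b, hl⟩ : ∃ a b, G.IsLink e a b := by
          cases h1 with
          | mk e' a b P' _ g hl hp he'' =>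
            rcases he with rfl | he
            · exact ⟨_, _, hl⟩
            · exact Graph.exists_isLink_of_mem_edgeSet (hp.subset_edgeSet he)
        have : a ∈ W₁ ∩ W₂ := ⟨(h1.ends he hl).1, (h2'.ends he' hl).1⟩
        rw [hW] at this; exact this
      · obtain ⟨a, b, hl, ha, hb, hab⟩ := hP.exists_link he'
        have h3 : a ∈ W ∩ W₁ := ⟨ha, (h1.ends he hl).1⟩
        have h4 : b ∈ W ∩ W₁ := ⟨hb, (h1.ends he hl).2⟩
        rw [hu] at h3 h4
        exact hab (h3.trans h4.symm)
    have hY : Unb ψ (C₂ ∪ P) u :=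
      (h2.unb Set.subset_union_left hv'.2).trans (hP.reverse.reach Set.subset_union_right)
    obtain ⟨e, he, h⟩ := h1.exists_mem_closure (X := C₁ ∪ C₂ ∪ P) hu'.2 hY hd
      (Set.subset_union_left.trans Set.subset_union_left) (by rw [Set.union_assoc]; simp)
    exact ⟨e, Or.inl (Or.inl he), h⟩

theorem IsFrameCircuit.finite {C : Set β} (h : IsFrameCircuit ψ C) : C.Finite := by
  rcases h with ⟨W, h⟩ | ⟨h, -⟩ | h | h
  · exact h.finite
  · obtain ⟨u, v, P₁, P₂, P₃, W₁, W₂, W₃, g₁, g₂, g₃, -, h1, h2, h3, -, -, -, -, -, -, rfl⟩ := h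
    exact (h1.finite.union h2.finite).union h3.finite
  · obtain ⟨C₁, C₂, W₁, W₂, x, ⟨⟨g, h1⟩, -⟩, ⟨⟨g', h2⟩, -⟩, -, -, rfl⟩ := h
    exact h1.finite.union h2.finite
  · obtain ⟨C₁, C₂, P, W₁, W₂, W, u, v, k, ⟨⟨g, h1⟩, -⟩, ⟨⟨g', h2⟩, -⟩, h3, -, -, -, rfl⟩ := h
    exact (h1.finite.union h2.finite).union h3.finite

/-- Vertices joined by a walk are joined by a path. -/
theorem Reach.exists_path {X : Set β} {x y} {g : Γ} (h : Reach ψ X x y g)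
    (hy : y ∈ G.vertexSet) : ∃ P W k, IsPath ψ x y P W k ∧ P ⊆ X := by
  have step : ∀ {e u v}, e ∈ X → G.IsLink e u v → (∃ P W k, IsPath ψ v y P W k ∧ P ⊆ X) →
      ∃ P W k, IsPath ψ u y P W k ∧ P ⊆ X := by
    rintro e u v he hl ⟨P, W, k, hp, hP⟩
    by_cases hu : u ∈ W
    · obtain ⟨P₁, W₁, g₁, P₂, W₂, g₂, h1, h2, rfl, -⟩ := hp.split hu
      exact ⟨_, _, _, h2, Set.subset_union_right.trans hP⟩
    · exact ⟨_, _, _, .cons e u v y P W k hl hp hu, Set.insert_subset he hP⟩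
  induction h with
  | nil u => exact ⟨_, _, _, .nil u hy, by simp⟩
  | cons e u v x g he hl _ ih => exact step he hl (ih hy step)
  | consInv e u v x g he hl _ ih => exact step he hl (ih hy step)

/-- A walk can be shortened to a path with the same value, unless it meets a component that
contains an unbalanced cycle. -/
theorem Reach.path_or_cycle {X : Set β} {x y} {g : Γ} (h : Reach ψ X x y g)
    (hy : y ∈ G.vertexSet) : (∃ P W, IsPath ψ x y P W g ∧ P ⊆ X) ∨
      ∃ C W k z a, IsCycle ψ C W k ∧ k ≠ 1 ∧ C ⊆ X ∧ z ∈ W ∧ Reach ψ X x z a := by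
  have step : ∀ {e u v g}, e ∈ X → G.IsLink e u v →
      ((∃ P W, IsPath ψ v y P W g ∧ P ⊆ X) ∨
        ∃ C W k z a, IsCycle ψ C W k ∧ k ≠ 1 ∧ C ⊆ X ∧ z ∈ W ∧ Reach ψ X v z a) →
      ((∃ P W, IsPath ψ u y P W (ψ.val e u v * g) ∧ P ⊆ X) ∨
        ∃ C W k z a, IsCycle ψ C W k ∧ k ≠ 1 ∧ C ⊆ X ∧ z ∈ W ∧ Reach ψ X u z a) := by
    rintro e u v g he hl (⟨P, W, hp, hP⟩ | ⟨C, W, k, z, a, h1, h2, h3, h4, h5⟩)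
    · by_cases hu : u ∈ W
      · obtain ⟨P₁, W₁, g₁, P₂, W₂, g₂, h1, h2, rfl, -, -, rfl⟩ := hp.split hu
        have hP₁ : P₁ ⊆ X := Set.subset_union_left.trans hP
        have hP₂ : P₂ ⊆ X := Set.subset_union_right.trans hP
        by_cases heP : e ∈ P₁
        · have := h1.gain_of_mem heP hl.symm
          have huv := (h1.ends heP hl).2.2
          left
          refine ⟨P₂, W₂, ?_, hP₂⟩
          rwa [this, ψ.val_symm e u v hl huv, mul_inv_cancel_left]
        · by_cases hk : ψ.val e u v * g₁ = 1
          · left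
            refine ⟨P₂, W₂, ?_, hP₂⟩
            rwa [← mul_assoc, hk, one_mul]
          · right
            exact ⟨_, _, _, u, 1, .mk e u v _ _ _ hl h1 heP, hk, Set.insert_subset he hP₁,
              h1.right_mem, .nil u⟩
      · exact Or.inl ⟨_, _, .cons e u v y P W _ hl hp hu, Set.insert_subset he hP⟩
    · exact Or.inr ⟨C, W, k, z, _, h1, h2, h3, h4, .cons e u v z a he hl h5⟩
  induction h with
  | nil u => exact Or.inl ⟨_, _, .nil u hy, by simp⟩
  | cons e u v x g he hl _ ih => exact step he hl (ih hy step)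
  | consInv e u v x g he hl _ ih =>
    by_cases huv : u = v
    · subst huv
      by_cases h1 : ψ.val e u u = 1
      · rw [h1, inv_one, one_mul]; exact ih hy step
      · right
        refine ⟨_, _, _, u, 1, .mk e u u ∅ {u} 1 hl (.nil u hl.left_mem) (by simp), by simpa,
          by simpa using he, rfl, .nil u⟩
    · rw [← ψ.val_symm e v u hl.symm (Ne.symm huv)]
      exact step he hl (ih hy step)

theorem Unb.exists_cycle {X : Set β} {x} (h : Unb ψ X x) (hx : x ∈ G.vertexSet) :
    ∃ C W k z a, IsCycle ψ C W k ∧ k ≠ 1 ∧ C ⊆ X ∧ z ∈ W ∧ Reach ψ X x z a := by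
  obtain ⟨g, hg, h⟩ := h
  refine (h.path_or_cycle hx).resolve_left ?_
  rintro ⟨P, W, hp, -⟩
  exact hg hp.eq_nil.2.2

theorem exists_circuit_of_mem_closure {X : Set β} {e : β} (he : e ∈ frameClosure ψ X)
    (heX : e ∉ X) : ∃ C ⊆ insert e X, IsFrameCircuit ψ C := by
  by_contra! hno
  have hX : X ⊆ insert e X := Set.subset_insert e X
  have hbal : ∀ C ⊆ insert e X, ¬ IsBalancedCycle ψ C := fun C hC h => hno C hC (Or.inl h)
  have hunb : ∀ {C W g}, IsCycle ψ C W g → C ⊆ insert e X → IsUnbalancedCycle ψ C W :=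
    fun h hC => ⟨⟨_, h⟩, hbal _ hC⟩
  obtain ⟨u, v, hl, h⟩ := he
  have hu := hl.left_mem
  have hv := hl.right_mem
  by_cases hconn : ∃ k, Reach ψ X u v k
  · obtain ⟨k, hk⟩ := hconn
    -- an unbalanced cycle in the component of `X` that contains `u` and `v`
    obtain ⟨C, W, k', z, a, hC, -, hCX, hz, ha⟩ :
        ∃ C W k z a, IsCycle ψ C W k ∧ k ≠ 1 ∧ C ⊆ X ∧ z ∈ W ∧ Reach ψ X u z a := by
      rcases h with h | h
      · refine (h.path_or_cycle hv).resolve_left ?_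
        rintro ⟨P, W, hp, hP⟩
        refine hbal (insert e P) (Set.insert_subset_insert hP) ⟨W, ?_⟩
        have := IsCycle.mk e u v P W _ hl hp.reverse fun h => heX (hP h)
        rwa [mul_inv_cancel] at this
      · exact h.1.exists_cycle hu
    have hzV := hC.subset_vertexSet hz
    have heC : e ∉ C := fun h => heX (hCX h)
    obtain ⟨PB₀, WB₀, b₀, hB₀, hPB₀⟩ := (hk.symm.trans ha).exists_path hzV
    obtain ⟨t, PB, WB, b, hB, hPB, -, htW, hBW⟩ := hB₀.firstHit hz
    obtain ⟨PA₀, WA₀, a₀, hA₀, hPA₀⟩ := ha.exists_path hzV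
    obtain ⟨s, PA, WA, a', hA, hPA, -, hsW, hAW⟩ :=
      hA₀.firstHit (S := WB ∪ W) (Or.inr hz)
    replace hPB := hPB.trans hPB₀
    replace hPA := hPA.trans hPA₀
    have heA : e ∉ PA := fun h => heX (hPA h)
    have heB : e ∉ PB := fun h => heX (hPB h)
    by_cases hsB : s ∈ WB
    · -- a handcuff
      obtain ⟨B₁, WB₁, b₁, B₂, WB₂, b₂, hB₁, hB₂, rfl, rfl, hBB, -⟩ := hB.split hsB
      have hp := hB₁.append hA.reverse fun y h1 h2 => hAW y h2 (Or.inl (Or.inl h1))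
      have heP : e ∉ B₁ ∪ PA := by
        rintro (h | h)
        · exact heB (Or.inl h)
        · exact heA h
      have hD := IsCycle.mk e u v _ _ _ hl hp heP
      have hPX : B₁ ∪ PA ⊆ X := Set.union_subset (Set.subset_union_left.trans hPB) hPA
      have hDX : insert e (B₁ ∪ PA) ⊆ insert e X := Set.insert_subset_insert hPX
      have hDW : ∀ y ∈ WB₁ ∪ WA, y ∈ W → y = s := by
        rintro y (hy | hy) hyW
        · have : y = t := hBW y (Or.inl hy) hyW
          subst this
          exact hBB y hy hB₂.right_mem
        · exact hAW y hy (Or.inr hyW)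
      by_cases hst : s = t
      · subst hst
        refine hno (insert e (B₁ ∪ PA) ∪ C) (Set.union_subset hDX (hCX.trans hX))
          (Or.inr (Or.inr (Or.inl ⟨_, _, _, _, s, hunb hD hDX, hunb hC (hCX.trans hX), ?_, ?_,
            rfl⟩)))
        · rw [Set.disjoint_left]
          rintro f (rfl | hf) hf'
          · exact heC hf'
          · obtain ⟨p, q, hpq, h1, h2, h3⟩ := hp.exists_link hf
            have := hC.ends hf' hpq
            exact h3 ((hDW p h1 this.1).trans (hDW q h2 this.2).symm)
        · ext y
          constructor
          · rintro ⟨h1, h2⟩; exact hDW y h1 h2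
          · rintro rfl; exact ⟨Or.inl hB₁.right_mem, htW⟩
      · have hsW' : s ∉ W := fun h => hst (hBW s (Or.inr hB₂.left_mem) h)
        refine hno (insert e (B₁ ∪ PA) ∪ C ∪ B₂) (Set.union_subset (Set.union_subset hDX
          (hCX.trans hX)) ((Set.subset_union_right.trans hPB).trans hX))
          (Or.inr (Or.inr (Or.inr ⟨_, _, _, _, _, _, s, t, _, hunb hD hDX,
            hunb hC (hCX.trans hX), hB₂, ?_, ?_, ?_, rfl⟩)))
        · ext y
          simp only [Set.mem_inter_iff, Set.mem_empty_iff_false, iff_false]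
          rintro ⟨h1, h2⟩
          exact hsW' (hDW y h1 h2 ▸ h2)
        · ext y
          constructor
          · rintro ⟨h1, h2 | h2⟩
            · exact hBB y h2 h1
            · exact hAW y h2 (Or.inl (Or.inr h1))
          · rintro rfl; exact ⟨hB₂.left_mem, Or.inl hB₁.right_mem⟩
        · ext y
          constructor
          · rintro ⟨h1, h2⟩; exact hBW y (Or.inr h1) h2
          · rintro rfl; exact ⟨hB₂.right_mem, htW⟩
    · -- a theta graph
      replace hsW : s ∈ W := hsW.resolve_left hsB
      have hst : s ≠ t := fun h => hsB (h ▸ hB.right_mem)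
      have hAB : ∀ y ∈ WA, y ∉ WB := fun y h1 h2 => hsB (hAW y h1 (Or.inl h2) ▸ h2)
      have huv : u ≠ v := fun h => hAB u hA.left_mem (h ▸ hB.left_mem)
      obtain ⟨P₁, W₁, g₁, P₂, W₂, g₂, h1, h2, h3, h4, rfl, rfl⟩ := hC.arcs hsW htW hst
      have hQ := (hA.reverse.append (IsPath.single (ψ := ψ) hl huv) (by
        rintro y hy (rfl | rfl)
        · rfl
        · exact absurd hB.left_mem (hAB y hy))).append hB (by
        rintro y (hy | (rfl | rfl)) hy'
        · exact absurd hy' (hAB y hy)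
        · exact absurd hy' (hAB y hA.left_mem)
        · rfl)
      have hQW : ∀ y ∈ WA ∪ {u, v} ∪ WB, y ∈ W₁ ∪ W₂ → y = s ∨ y = t := by
        rintro y ((hy | (rfl | rfl)) | hy) hy'
        · exact Or.inl (hAW y hy (Or.inr hy'))
        · exact Or.inl (hAW y hA.left_mem (Or.inr hy'))
        · exact Or.inr (hBW y hB.left_mem hy')
        · exact Or.inr (hBW y hy hy')
      have hdis : Disjoint (P₁ ∪ P₂) (PA ∪ {e} ∪ PB) := by
        rw [Set.disjoint_left]
        rintro f hf ((hf' | rfl) | hf')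
        · obtain ⟨p, q, hpq, h1, h2, h3⟩ := hA.exists_link hf'
          have := hC.ends hf hpq
          exact h3 ((hAW p h1 (Or.inr this.1)).trans (hAW q h2 (Or.inr this.2)).symm)
        · exact heC hf
        · obtain ⟨p, q, hpq, h1, h2, h3⟩ := hB.exists_link hf'
          have := hC.ends hf hpq
          exact h3 ((hBW p h1 this.1).trans (hBW q h2 this.2).symm)
      have hsub : P₁ ∪ P₂ ∪ (PA ∪ {e} ∪ PB) ⊆ insert e X := by
        refine Set.union_subset (hCX.trans hX) (Set.union_subset (Set.union_subset
          (hPA.trans hX) (by simp)) (hPB.trans hX))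
      rw [Set.disjoint_union_left] at hdis
      refine hno _ hsub (Or.inr (Or.inl ⟨⟨s, t, _, _, _, _, _, _, _, _, _, hst, h1, h2, hQ, h3,
        hdis.1, hdis.2, h4, ?_, ?_, rfl⟩, fun D hD => hbal D (hD.trans hsub)⟩))
      · ext y
        constructor
        · rintro ⟨h5, h6⟩; exact hQW y h6 (Or.inl h5)
        · rintro (rfl | rfl)
          · exact ⟨h1.left_mem, hQ.left_mem⟩
          · exact ⟨h1.right_mem, hQ.right_mem⟩
      · ext y
        constructor
        · rintro ⟨h5, h6⟩; exact hQW y h6 (Or.inr h5)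
        · rintro (rfl | rfl)
          · exact ⟨h2.left_mem, hQ.left_mem⟩
          · exact ⟨h2.right_mem, hQ.right_mem⟩
  · -- the ends of `e` are in different unbalanced components: a loose handcuff
    have hno' : ∀ {y g k}, Reach ψ X u y g → Reach ψ X v y k → False :=
      fun h1 h2 => hconn ⟨_, h1.trans h2.symm⟩
    have h : Unb ψ X u ∧ Unb ψ X v := h.resolve_left fun h => hconn ⟨_, h⟩
    obtain ⟨C, W, k, z, a, hC, -, hCX, hz, ha⟩ := h.1.exists_cycle hu
    obtain ⟨C', W', k', z', a', hC', -, hCX', hz', ha'⟩ := h.2.exists_cycle hv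
    obtain ⟨PA₀, WA₀, a₀, hA₀, hPA₀⟩ := ha.exists_path (hC.subset_vertexSet hz)
    obtain ⟨s, PA, WA, c, hA, hPA, -, hsW, hAW⟩ := hA₀.firstHit hz
    obtain ⟨PB₀, WB₀, b₀, hB₀, hPB₀⟩ := ha'.exists_path (hC'.subset_vertexSet hz')
    obtain ⟨t, PB, WB, d, hB, hPB, -, htW, hBW⟩ := hB₀.firstHit hz'
    replace hPB := hPB.trans hPB₀
    replace hPA := hPA.trans hPA₀
    have rA : ∀ y ∈ WA, ∃ k, Reach ψ X u y k := fun y hy => hA.reach_mem hPA hy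
    have rB : ∀ y ∈ WB, ∃ k, Reach ψ X v y k := fun y hy => hB.reach_mem hPB hy
    have rC : ∀ y ∈ W, ∃ k, Reach ψ X u y k := fun y hy => by
      obtain ⟨k, hk⟩ := hC.reach_mem hCX hz hy
      exact ⟨_, ha.trans hk⟩
    have rC' : ∀ y ∈ W', ∃ k, Reach ψ X v y k := fun y hy => by
      obtain ⟨k, hk⟩ := hC'.reach_mem hCX' hz' hy
      exact ⟨_, ha'.trans hk⟩
    have huv' : ∀ y, (∃ k, Reach ψ X u y k) → (∃ k, Reach ψ X v y k) → False :=
      fun y ⟨_, h1⟩ ⟨_, h2⟩ => hno' h1 h2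
    have huv : u ≠ v := fun h => hconn ⟨1, h ▸ .nil u⟩
    have hQ := (hA.reverse.append (IsPath.single (ψ := ψ) hl huv) (by
      rintro y hy (rfl | rfl)
      · rfl
      · exact (huv' y (rA y hy) ⟨_, .nil y⟩).elim)).append hB (by
      rintro y (hy | (rfl | rfl)) hy'
      · exact (huv' y (rA y hy) (rB y hy')).elim
      · exact (huv' y ⟨_, .nil y⟩ (rB y hy')).elim
      · rfl)
    refine hno (C ∪ C' ∪ (PA ∪ {e} ∪ PB)) ?_ (Or.inr (Or.inr (Or.inr ⟨_, _, _, _, _, _, s, t, _,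
      hunb hC (hCX.trans hX), hunb hC' (hCX'.trans hX), hQ, ?_, ?_, ?_, rfl⟩)))
    · exact Set.union_subset (Set.union_subset (hCX.trans hX) (hCX'.trans hX))
        (Set.union_subset (Set.union_subset (hPA.trans hX) (by simp)) (hPB.trans hX))
    · ext y
      simp only [Set.mem_inter_iff, Set.mem_empty_iff_false, iff_false]
      rintro ⟨h1, h2⟩
      exact huv' y (rC y h1) (rC' y h2)
    · ext y
      constructor
      · rintro ⟨(h1 | (rfl | rfl)) | h1, h2⟩
        · exact hAW y h1 h2
        · exact hAW y hA.left_mem h2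
        · exact (huv' y (rC y h2) ⟨_, .nil y⟩).elim
        · exact (huv' y (rC y h2) (rB y h1)).elim
      · rintro rfl; exact ⟨hQ.left_mem, hsW⟩
    · ext y
      constructor
      · rintro ⟨(h1 | (rfl | rfl)) | h1, h2⟩
        · exact (huv' y (rA y h1) (rC' y h2)).elim
        · exact (huv' y ⟨_, .nil y⟩ (rC' y h2)).elim
        · exact hBW y hB.left_mem h2
        · exact hBW y h1 h2
      · rintro rfl; exact ⟨hQ.right_mem, htW⟩

/-- A set of edges contains no circuit if and only if none of its elements is spanned by the
others. -/
theorem no_circuit_iff {I : Set β} :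
    (∀ C ⊆ I, ¬ IsFrameCircuit ψ C) ↔ ∀ e ∈ I, e ∉ frameClosure ψ (I \ {e}) := by
  constructor
  · intro h e he hcl
    obtain ⟨C, hC, hC'⟩ := exists_circuit_of_mem_closure hcl (by simp)
    exact h C (hC.trans (by simp [he])) hC'
  · intro h C hC hC'
    obtain ⟨e, he, hcl⟩ := hC'.exists_mem_closure
    exact h e (hC he) (frameClosure_mono (Set.sdiff_subset_sdiff_left hC) hcl)

theorem ncard_le_of_subset_closure {J : Set β} (hJ : ∀ e ∈ J, e ∉ frameClosure ψ (J \ {e}))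
    (hJE : J ⊆ G.edgeSet) : ∀ (n : ℕ) (I : Set β), I.Finite → I ⊆ G.edgeSet →
      (I \ J).ncard = n → J ⊆ frameClosure ψ I → J.ncard ≤ I.ncard := by
  intro n
  induction n using Nat.strong_induction_on with
  | _ n ih =>
    intro I hI hIE hn hJI
    by_cases hIJ : I ⊆ J
    · have : J ⊆ I := by
        intro e he
        by_contra heI
        exact hJ e he (frameClosure_mono (Set.subset_sdiff_singleton hIJ heI) (hJI he))
      rw [hIJ.antisymm this]
    · obtain ⟨i, hiI, hiJ⟩ := Set.not_subset.1 hIJ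
      have hlt : ∀ I' : Set β, I' \ J ⊆ (I \ J) \ {i} → (I' \ J).ncard < n := by
        intro I' h
        rw [← hn]
        exact Set.ncard_lt_ncard ⟨h.trans Set.sdiff_subset, fun h' => (h (h' ⟨hiI, hiJ⟩)).2 rfl⟩
          hI.sdiff
      by_cases hJi : J ⊆ frameClosure ψ (I \ {i})
      · have := ih _ (hlt (I \ {i}) (by grind)) (I \ {i}) hI.sdiff
          (Set.sdiff_subset.trans hIE) rfl hJi
        exact this.trans (Set.ncard_le_ncard Set.sdiff_subset hI)
      · obtain ⟨j, hj, hji⟩ := Set.not_subset.1 hJi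
        have hins : insert i (I \ {i}) = I := by simp [hiI]
        have hex := frameClosure_exchange (e := i) (X := I \ {i}) (hIE hiI)
          (by rw [hins]; exact hJI hj) hji
        have hE' : insert j (I \ {i}) ⊆ G.edgeSet :=
          Set.insert_subset (hJE hj) (Set.sdiff_subset.trans hIE)
        have hIcl : I ⊆ frameClosure ψ (insert j (I \ {i})) := by
          intro x hx
          by_cases hxi : x = i
          · exact hxi ▸ hex
          · exact subset_frameClosure (ψ := ψ) hE' (Or.inr ⟨hx, hxi⟩)
        have := ih _ (hlt (insert j (I \ {i})) (by grind)) _ (hI.sdiff.insert j) hE' rfl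
          (hJI.trans (frameClosure_idem hIcl))
        refine this.trans ((Set.ncard_insert_le _ _).trans ?_)
        rw [Set.ncard_sdiff_singleton_add_one hiI hI]

theorem frame_aug {I J : Set β} (hI : I ⊆ G.edgeSet ∧ ∀ C ⊆ I, ¬ IsFrameCircuit ψ C)
    (hIf : I.Finite) (hJ : J ⊆ G.edgeSet ∧ ∀ C ⊆ J, ¬ IsFrameCircuit ψ C)
    (hlt : I.ncard < J.ncard) : ∃ e ∈ J, e ∉ I ∧ insert e I ⊆ G.edgeSet ∧
      ∀ C ⊆ insert e I, ¬ IsFrameCircuit ψ C := by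
  have hJI : ¬ J ⊆ frameClosure ψ I := fun h =>
    absurd (ncard_le_of_subset_closure (ψ := ψ) (no_circuit_iff.1 hJ.2) hJ.1 _ I hIf hI.1 rfl h)
      (not_le.2 hlt)
  obtain ⟨e, he, heI⟩ := Set.not_subset.1 hJI
  have heI' : e ∉ I := fun h => heI (subset_frameClosure hI.1 h)
  refine ⟨e, he, heI', Set.insert_subset (hJ.1 he) hI.1, no_circuit_iff.2 ?_⟩
  rintro f (rfl | hf) hcl
  · exact heI (by simpa [heI'] using hcl)
  · have hfe : f ≠ e := fun h => heI' (h ▸ hf)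
    have h1 : insert e I \ {f} = insert e (I \ {f}) := by
      rw [Set.insert_sdiff_of_notMem _ (by simpa using hfe.symm)]
    rw [h1] at hcl
    have := frameClosure_exchange (hJ.1 he) hcl (no_circuit_iff.1 hI.2 f hf)
    exact heI (by simpa [hf] using this)

end Closure

/-- The frame matroid of a gain graph: the matroid on the edge set whose circuits are the balanced
cycles and the theta graphs and handcuffs without balanced cycles. A set of edges is independent
when it contains none of these circuits. -/
def frameMatroid {α β Γ : Type*} [Group Γ] {G : Graph α β} (ψ : GainFunction G Γ) : Matroid β :=
  (IndepMatroid.ofFinitaryCardAugment G.edgeSet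
    (fun I => I ⊆ G.edgeSet ∧ ∀ C ⊆ I, ¬ IsFrameCircuit ψ C)
    ⟨Set.empty_subset _, (no_circuit_iff (ψ := ψ)).2 (by simp)⟩
    (fun _ _ hJ hIJ => ⟨hIJ.trans hJ.1, fun C hC => hJ.2 C (hC.trans hIJ)⟩)
    (fun _ _ hI hIf hJ _ hlt => frame_aug hI hIf hJ hlt)
    (fun _ h => ⟨fun _ he => (h _ (Set.singleton_subset_iff.2 he) (Set.finite_singleton _)).1 rfl,
      fun C hC hC' => (h C hC hC'.finite).2 C subset_rfl hC'⟩)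
    (fun _ h => h.1)).matroid

theorem frameMatroid_indep_iff {α β Γ : Type*} [Group Γ] {G : Graph α β}
    (ψ : GainFunction G Γ) (I : Set β) : (frameMatroid ψ).Indep I ↔
      I ⊆ G.edgeSet ∧ ∀ C ⊆ I, ¬ IsFrameCircuit ψ C :=
  Iff.rfl


section Gain

variable {α β Γ : Type*} [Group Γ] {G : Graph α β}

/-- The gain function `ψ/Γ₁` with values in the quotient group. -/
def GainFunction.quotient (ψ : GainFunction G Γ) (Γ₁ : Subgroup Γ) [Γ₁.Normal] :
    GainFunction G (Γ ⧸ Γ₁) where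
  val e u v := (ψ.val e u v : Γ ⧸ Γ₁)
  val_symm e u v hl huv := by rw [ψ.val_symm e u v hl huv]; rfl

/-- The gain function obtained from `ψ` by the switching function `η`. -/
def GainFunction.switch (ψ : GainFunction G Γ) (η : α → Γ) : GainFunction G Γ where
  val e u v := (η u)⁻¹ * ψ.val e u v * η v
  val_symm e u v hl huv := by rw [ψ.val_symm e u v hl huv]; group

/-- The edges of the complete `n`-vertex `Γ`-gain graph: pairs `i < j` labelled by elements
of `Γ`. -/
abbrev CompleteEdge (n : ℕ) (Γ : Type*) : Type _ := {p : Fin n × Fin n // p.1 < p.2} × Γ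

/-- The complete graph with one edge between `i` and `j` for each element of `Γ`. -/
def completeGraph (n : ℕ) (Γ : Type*) : Graph (Fin n) (CompleteEdge n Γ) where
  vertexSet := Set.univ
  IsLink e x y := (x = e.1.1.1 ∧ y = e.1.1.2) ∨ (x = e.1.1.2 ∧ y = e.1.1.1)
  isLink_symm _ _ := ⟨fun _ _ h => by tauto⟩
  eq_or_eq_of_isLink_of_isLink := by grind
  left_mem_of_isLink := by simp

/-- The gain function of the complete `Γ`-gain graph: the edge labelled `a` between `i < j` has
gain `a` when oriented from `i` to `j`. -/
def completeGain (n : ℕ) (Γ : Type*) [Group Γ] : GainFunction (completeGraph n Γ) Γ where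
  val e x y := if x < y then e.2 else e.2⁻¹
  val_symm e x y _ hxy := by
    rcases lt_or_gt_of_ne hxy with h | h <;> simp [h, h.not_gt]

/-- A subgroup `A` is malnormal if its conjugates by elements outside `A` meet `A` only in the
identity. -/
def IsMalnormal (A : Subgroup Γ) : Prop :=
  ∀ g ∉ A, ∀ a ∈ A, g⁻¹ * a * g ∈ A → a = 1

/-- `{Γ₁} ∪ 𝒜` is a Frobenius partition of `Γ`. -/
structure IsFrobeniusPartition (Γ₁ : Subgroup Γ) (𝒜 : Set (Subgroup Γ)) : Prop where
  normal : Γ₁.Normal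
  nontrivial : ∀ A ∈ 𝒜, A ≠ ⊥
  partition : ∀ g : Γ, g ≠ 1 → ∃! H : Subgroup Γ, H ∈ insert Γ₁ 𝒜 ∧ g ∈ H
  malnormal : ∀ A ∈ 𝒜, IsMalnormal A
  conj_mem : ∀ A ∈ 𝒜, ∀ g : Γ, A.map (MulAut.conj g).toMonoidHom ∈ 𝒜

/-- The class `𝒞(Γ, Γ₁, 𝒜, G, ψ)` of circuits of the frame matroid `F(G, ψ/Γ₁)`: the `ψ`-balanced
cycles, and the handcuffs and theta graphs all of whose gains (in both orientations) lie in one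
group `A ∈ 𝒜` after some switching. -/
def gainClass (Γ₁ : Subgroup Γ) [Γ₁.Normal] (𝒜 : Set (Subgroup Γ)) (ψ : GainFunction G Γ) :
    Set (Set β) :=
  {C | (frameMatroid (ψ.quotient Γ₁)).IsCircuit C ∧
    (IsBalancedCycle ψ C ∨
      ((IsUnbalancedTheta (ψ.quotient Γ₁) C ∨ IsUnbalancedTightHandcuff (ψ.quotient Γ₁) C ∨
          IsUnbalancedLooseHandcuff (ψ.quotient Γ₁) C) ∧
        ∃ η : α → Γ, ∃ A ∈ 𝒜, ∀ e ∈ C, ∀ u v, G.IsLink e u v → (ψ.switch η).val e u v ∈ A))}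

end Gain

section Lift

variable {β : Type*}

/-- `M` is an elementary lift of `N`: some matroid `K` with one additional element `e` has
`K ＼ e = M` and `K ／ e = N`. -/
def IsElementaryLift (M N : Matroid β) : Prop :=
  ∃ K : Matroid (Option β), none ∈ K.E ∧
    K.delete {none} = M.mapEmbedding Function.Embedding.some ∧
    K.contract {none} = N.mapEmbedding Function.Embedding.some

/-- `𝒞` is a linear class of circuits of `N`. -/
def IsLinearClass (N : Matroid β) (𝒞 : Set (Set β)) : Prop :=
  (∀ C ∈ 𝒞, N.IsCircuit C) ∧
    ∀ C₁ ∈ 𝒞, ∀ C₂ ∈ 𝒞, (C₁ ∪ C₂).encard = N.eRk (C₁ ∪ C₂) + 2 →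
      ∀ C ⊆ C₁ ∪ C₂, N.IsCircuit C → C ∈ 𝒞

/-- `M` is the elementary lift of `N` given by the linear class `𝒞`: the matroid on the ground set
of `N` in which the rank of `X` is its rank in `N` if every circuit of `N` contained in `X` is
in `𝒞`, and is larger by one otherwise. -/
def IsLiftOfClass (M N : Matroid β) (𝒞 : Set (Set β)) : Prop :=
  IsLinearClass N 𝒞 ∧ M.E = N.E ∧ ∀ X ⊆ N.E,
    ((∀ C ⊆ X, N.IsCircuit C → C ∈ 𝒞) → M.eRk X = N.eRk X) ∧
    ((¬ ∀ C ⊆ X, N.IsCircuit C → C ∈ 𝒞) → M.eRk X = N.eRk X + 1)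

/-- `M` is the matroid `M(Γ, Γ₁, 𝒜, G, ψ)`: the elementary lift of the frame matroid `F(G, ψ/Γ₁)`
given by the linear class `𝒞(Γ, Γ₁, 𝒜, G, ψ)`. -/
def IsGainLift {α Γ : Type*} [Group Γ] {G : Graph α β} (M : Matroid β) (Γ₁ : Subgroup Γ)
    [Γ₁.Normal] (𝒜 : Set (Subgroup Γ)) (ψ : GainFunction G Γ) : Prop :=
  IsLiftOfClass M (frameMatroid (ψ.quotient Γ₁)) (gainClass Γ₁ 𝒜 ψ)

end Lift

end GainGraph

/-! Let $N=F(K_n^\Gamma,\psi/\Gamma_1)$, let $K$ have an element $e$ with $K\setminus e=M$ and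
$K/e=N$, and call $X$ bad if $e$ is in the closure of $X$ in $K$ (if $e$ is a loop of $K$, then
$M=N$ and no set is called bad). Bad sets have rank one larger in $M$ than in $N$, other sets have
the same rank in both, and every bad set contains a bad circuit of $N$. Hence $M$ is the lift given
by the circuits of $N$ that are not bad (`LiftFamily.isLiftOfClass`), and it remains to find
$\mathcal A$ and recognise these circuits.

Balanced triangles are circuits of $M$, so from an edge $i\to j$ of gain $g$ and an edge $j\to k$ of
gain $h$ the edge $i\to k$ of gain $gh$ is spanned. Fix a switching function $\eta$ and let $T$ be
the set of edges that it makes trivial. Modulo $T$ all edges with the same gain are parallel, and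
the gains of the edges spanned in $M$ by $T$ and the edges of gain $g$ form a subgroup,
`gainClosure`. Two parallel edges of $K_n^\Gamma$ never form a circuit of $M$; from this, $T$ spans
only trivial edges in $M$ (`arc_notMem_closure_trivial`). So closure exchange over $T$ applies to
every nontrivial edge, and the subgroups of elements outside $\Gamma_1$ partition
$\Gamma\setminus\Gamma_1$ and meet $\Gamma_1$ trivially.

For $g\notin\Gamma_1$ the edges with gains in the subgroup of $g$ form a set that is not bad
(`not_bad_gainClosure`). This makes membership in the subgroup a local question about a few edges at
one vertex (`arc_mem_closure_of_mem_gainClosure`), so the subgroup does not depend on $\eta$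
(`gainClosure_switch`). Switching by constants shows that the family is closed under conjugation,
and switching at single vertices, with an exchange on four vertices, shows malnormality
(`mem_gainClosure_of_conj_mem`).

A theta graph or handcuff that is a circuit of $N$ can be switched so that all but two of its edges
are trivial (`exists_switch_of_isCircuit`). If it is a circuit of $M$, then the gain of one of the
two edges is in the subgroup of the other; this identifies the linear class (`gainClass_eq`). -/

namespace GainGraph

/-! ### Elementary lifts: bad sets, ranks and the linear class -/

section MatroidLift

open Matroid

variable {β : Type*} {M N : Matroid β}

/-- The properties of an elementary lift `M` of `N` together with the family `B` of sets whose
closure, in the one-element coextension of `N` that has `M` as a deletion, contains the new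
element. -/
structure LiftFamily (M N : Matroid β) (B : Set β → Prop) : Prop where
  ground_eq : M.E = N.E
  mono : ∀ {X Y}, X ⊆ Y → B X → B Y
  of_closure : ∀ {X}, B (M.closure X) → B X
  closure_subset_of_bad : ∀ {X}, B X → N.closure X ⊆ M.closure X
  exchange : ∀ {X f}, f ∈ N.closure X → f ∉ M.closure X → B (insert f X)
  closure_subset : ∀ X, M.closure X ⊆ N.closure X
  not_bad : ∀ {I}, N.Indep I → ¬ B I

/-- Translating closures in `M` and `N` into closures in `K` turns every field into a standard
closure property of `K`, with the exchange axiom for `none` giving `exchange`. -/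
theorem IsElementaryLift.exists_liftFamily (h : IsElementaryLift M N) :
    ∃ B, LiftFamily M N B := by
  obtain ⟨K, he, hM, hN⟩ := h
  have hinj : Function.Injective (some : β → Option β) := Option.some_injective β
  have hd : ∀ X : Set β, (some '' X) \ {none} = some '' X := fun X => by ext (_ | x) <;> simp
  have clM : ∀ (X : Set β) f, f ∈ M.closure X ↔ some f ∈ K.closure (some '' X) := by
    intro X f
    have h1 : (M.mapEmbedding Function.Embedding.some).closure (some '' X)
        = some '' M.closure X := by
      rw [mapEmbedding, map_closure_eq]
      simp [Set.preimage_image_eq _ hinj]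
    rw [← hM, delete_closure_eq, hd] at h1
    have := Set.ext_iff.1 h1 (some f)
    simpa using this.symm
  have clN : ∀ (X : Set β) f, f ∈ N.closure X ↔
      some f ∈ K.closure (insert none (some '' X)) := by
    intro X f
    have h1 : (N.mapEmbedding Function.Embedding.some).closure (some '' X)
        = some '' N.closure X := by
      rw [mapEmbedding, map_closure_eq]
      simp [Set.preimage_image_eq _ hinj]
    rw [← hN, contract_closure_eq, Set.union_singleton] at h1
    have := Set.ext_iff.1 h1 (some f)
    simpa using this.symm
  have hE : M.E = N.E := by
    have h1 := congrArg Matroid.E hM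
    have h2 := congrArg Matroid.E hN
    simp only [delete_ground, contract_ground, mapEmbedding_ground_eq] at h1 h2
    exact hinj.image_injective (h1.symm.trans h2)
  -- A loop lies in every closure, so the family used below would violate `not_bad`. In this case `M
  -- = N`, and the empty family works.
  by_cases hl : K.IsLoop none
  · have hMN : M = N := by
      refine ext_closure fun X => ?_
      ext f
      rw [clM, clN, closure_insert_eq_of_mem_closure (hl.mem_closure _)]
    subst hMN
    exact ⟨fun _ => False, rfl, fun _ h => h, fun h => h, fun h => h.elim,
      fun h h' => h' h, fun _ => subset_rfl, fun _ h => h⟩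
  have hnl : K.IsNonloop none := ⟨hl, he⟩
  refine ⟨fun X => none ∈ K.closure (some '' X), hE, ?_, ?_, ?_, ?_, ?_, ?_⟩
  · exact fun h h' => K.closure_subset_closure (Set.image_mono h) h'
  · intro X h
    refine K.closure_subset_closure_of_subset_closure ?_ h
    rintro _ ⟨f, hf, rfl⟩
    exact (clM X f).1 hf
  · intro X h f hf
    rw [clN, closure_insert_eq_of_mem_closure h] at hf
    exact (clM X f).2 hf
  · intro X f h h'
    rw [clN] at h
    rw [clM] at h'
    rw [Set.image_insert_eq]
    exact (K.closure_exchange ⟨h, h'⟩).1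
  · intro X f hf
    rw [clM] at hf
    exact (clN X f).2 (K.closure_subset_closure (Set.subset_insert _ _) hf)
  · intro I hI h
    have h1 := hI.mapEmbedding Function.Embedding.some
    rw [← hN, hnl.contractElem_indep_iff] at h1
    have h2 := h1.2.notMem_closure_sdiff_of_mem (Set.mem_insert _ _)
    rw [Set.insert_sdiff_self_of_notMem h1.1] at h2
    exact h2 h

namespace LiftFamily

variable {B : Set β → Prop} (hB : LiftFamily M N B)

include hB

theorem bad_of_subset_closure {X Y : Set β} (h : B Y) (hYX : Y ⊆ M.closure X) : B X :=
  hB.of_closure (hB.mono hYX h)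

theorem indep {I : Set β} (hI : N.Indep I) : M.Indep I := by
  rw [indep_iff_forall_notMem_closure_sdiff (hB.ground_eq ▸ hI.subset_ground)]
  exact fun e he h => hI.notMem_closure_sdiff_of_mem he (hB.closure_subset _ h)

/-- An element of `X` spanned by `I` in `N` but not in `M` would, by exchange, make a subset of `X`
bad. -/
theorem isBasis_of_not_bad {I X : Set β} (hI : N.IsBasis I X) (hX : ¬ B X) : M.IsBasis I X := by
  refine isBasis_iff_indep_subset_closure.2 ⟨hB.indep hI.indep, hI.subset, fun f hf => ?_⟩
  by_contra hf'
  exact hX (hB.mono (Set.insert_subset hf hI.subset)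
    (hB.exchange (hI.subset_closure hf) hf'))

/-- If `I` spanned `X` in `M`, badness would pass to the `N`-independent set `I`. So some `f` is
missed; then `insert f I` is bad by exchange, and the `M`-closure of a bad set contains its
`N`-closure. -/
theorem exists_isBasis_insert_of_bad {I X : Set β} (hI : N.IsBasis I X) (hX : B X) :
    ∃ f ∈ X, f ∉ M.closure I ∧ f ∈ N.closure I ∧ M.IsBasis (insert f I) X := by
  obtain ⟨f, hf, hf'⟩ : ∃ f ∈ X, f ∉ M.closure I := by
    by_contra! h
    exact hB.not_bad hI.indep (hB.bad_of_subset_closure hX h)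
  have hfN := hI.subset_closure hf
  refine ⟨f, hf, hf', hfN, isBasis_iff_indep_subset_closure.2
    ⟨?_, Set.insert_subset hf hI.subset, ?_⟩⟩
  · rw [insert_indep_iff]
    exact ⟨hB.indep hI.indep, fun _ => ⟨hB.ground_eq ▸ hI.subset_ground hf, hf'⟩⟩
  · refine subset_trans ?_ (hB.closure_subset_of_bad (hB.exchange hfN hf'))
    exact hI.subset_closure.trans (N.closure_subset_closure (Set.subset_insert _ _))

theorem eRk_of_not_bad {X : Set β} (hXE : X ⊆ N.E) (hX : ¬ B X) : M.eRk X = N.eRk X := by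
  obtain ⟨I, hI⟩ := N.exists_isBasis X
  rw [← hI.encard_eq_eRk, ← (hB.isBasis_of_not_bad hI hX).encard_eq_eRk]

theorem eRk_of_bad {X : Set β} (hXE : X ⊆ N.E) (hX : B X) : M.eRk X = N.eRk X + 1 := by
  obtain ⟨I, hI⟩ := N.exists_isBasis X
  obtain ⟨f, hf, hf', hfN, hb⟩ := hB.exists_isBasis_insert_of_bad hI hX
  rw [← hI.encard_eq_eRk, ← hb.encard_eq_eRk, Set.encard_insert_of_notMem]
  exact fun h => hf' (M.mem_closure_of_mem h (hB.indep hI.indep).subset_ground)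

/-- The element `f` that must be added to an `N`-basis to get an `M`-basis has a fundamental circuit
in `N`, and exchange within that circuit shows that it is bad. -/
theorem exists_bad_isCircuit {X : Set β} (hXE : X ⊆ N.E) (hX : B X) :
    ∃ C ⊆ X, N.IsCircuit C ∧ B C := by
  obtain ⟨I, hI⟩ := N.exists_isBasis X
  obtain ⟨f, hf, hf', hfN, -⟩ := hB.exists_isBasis_insert_of_bad hI hX
  have hfI : f ∉ I := fun h => hf' (M.mem_closure_of_mem h (hB.indep hI.indep).subset_ground)
  obtain ⟨C, hCI, hC, hfC⟩ := (mem_closure_iff_exists_isCircuit hfI).1 hfN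
  refine ⟨C, hCI.trans (Set.insert_subset hf hI.subset), hC, ?_⟩
  have := hB.exchange (hC.mem_closure_sdiff_singleton_of_mem hfC)
    (fun h => hf' (M.closure_subset_closure (by grind) h))
  simpa [hfC] using this

theorem isCircuit_iff_not_bad {C : Set β} (hC : N.IsCircuit C) : M.IsCircuit C ↔ ¬ B C := by
  constructor
  · intro h hb
    obtain ⟨f, hf⟩ := hC.nonempty
    have hI : N.IsBasis (C \ {f}) C := hC.sdiff_singleton_isBasis hf
    obtain ⟨e, he, he', -, hb'⟩ := hB.exists_isBasis_insert_of_bad hI hb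
    have hef : e = f := by
      by_contra hne
      exact he' (M.mem_closure_of_mem ⟨he, hne⟩ (hB.indep hI.indep).subset_ground)
    subst hef
    have := hb'.indep
    rw [Set.insert_sdiff_self_of_mem he] at this
    exact h.not_indep this
  · intro hb
    rw [isCircuit_iff_forall_ssubset]
    refine ⟨?_, fun I hI => hB.indep (hC.ssubset_indep hI)⟩
    obtain ⟨f, hf⟩ := hC.nonempty
    have hI := hB.isBasis_of_not_bad (hC.sdiff_singleton_isBasis hf) hb
    refine ⟨fun hi => ?_, hB.ground_eq ▸ hC.subset_ground⟩
    have := hI.eq_of_subset_indep hi Set.sdiff_subset subset_rfl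
    exact (this ▸ hf).2 rfl

/-- A bad circuit inside `X = C₁ ∪ C₂` would give `X` rank `|X| - 1` in `M`. But `C₁` and `C₂` are
distinct circuits of `M`, so deleting `e ∈ C₁ \ C₂` and then some `f ∈ C₂` does not change the
`M`-closure, and the rank is at most `|X| - 2`. -/
theorem isLinearClass [N.Finite] : IsLinearClass N {C | N.IsCircuit C ∧ ¬ B C} := by
  refine ⟨fun C h => h.1, fun C₁ h₁ C₂ h₂ hr C hC hNC => ⟨hNC, fun hb => ?_⟩⟩
  have hE : C₁ ∪ C₂ ⊆ N.E := Set.union_subset h₁.1.subset_ground h₂.1.subset_ground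
  have hfin : (C₁ ∪ C₂).Finite := N.ground_finite.subset hE
  have hrk := hB.eRk_of_bad hE (hB.mono hC hb)
  have hM₁ := (hB.isCircuit_iff_not_bad h₁.1).2 h₁.2
  have hM₂ := (hB.isCircuit_iff_not_bad h₂.1).2 h₂.2
  have hne : C₁ ≠ C₂ := by
    rintro rfl
    rw [Set.union_self] at hC
    exact h₁.2 (hNC.eq_of_subset_isCircuit h₁.1 hC ▸ hb)
  obtain ⟨e, he₁, he₂⟩ : ∃ e ∈ C₁, e ∉ C₂ := by
    by_contra! h
    exact hne (hM₁.eq_of_subset_isCircuit hM₂ h)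
  set X := C₁ ∪ C₂ with hX
  have hcl : M.closure (X \ {e}) = M.closure X := by
    refine M.closure_sdiff_singleton_eq_closure ?_
    exact M.closure_subset_closure (Set.sdiff_subset_sdiff_left Set.subset_union_left)
      (hM₁.mem_closure_sdiff_singleton_of_mem he₁)
  obtain ⟨f, hf⟩ := hM₂.nonempty
  have hfe : f ≠ e := fun h => he₂ (h ▸ hf)
  have hcl' : M.closure ((X \ {e}) \ {f}) = M.closure (X \ {e}) := by
    refine M.closure_sdiff_singleton_eq_closure ?_
    refine M.closure_subset_closure ?_ (hM₂.mem_closure_sdiff_singleton_of_mem hf)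
    exact Set.sdiff_subset_sdiff_left (Set.subset_sdiff_singleton Set.subset_union_right he₂)
  have h1 : M.eRk X ≤ ((X \ {e}) \ {f}).encard := by
    rw [← M.eRk_closure_eq X, ← hcl, ← hcl', M.eRk_closure_eq]
    exact M.eRk_le_encard _
  have h2 : ((X \ {e}) \ {f}).encard + 1 + 1 = X.encard := by
    rw [Set.encard_sdiff_singleton_add_one, Set.encard_sdiff_singleton_add_one]
    · exact Or.inl he₁
    · exact ⟨Or.inr hf, hfe⟩
  have h3 : N.eRk X ≠ ⊤ := ((N.eRk_le_encard X).trans_lt hfin.encard_lt_top).ne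
  have h4 : ((X \ {e}) \ {f}).encard ≠ ⊤ := hfin.sdiff.sdiff.encard_lt_top.ne
  rw [hr] at h2
  rw [hrk] at h1
  lift N.eRk X to ℕ using h3 with a
  lift ((X \ {e}) \ {f}).encard to ℕ using h4 with b
  norm_cast at h1 h2
  omega

theorem isLiftOfClass [N.Finite] : IsLiftOfClass M N {C | N.IsCircuit C ∧ ¬ B C} := by
  refine ⟨hB.isLinearClass, hB.ground_eq, fun X hX => ⟨fun h => ?_, fun h => ?_⟩⟩
  · refine hB.eRk_of_not_bad hX fun hb => ?_
    obtain ⟨C, hCX, hC, hb'⟩ := hB.exists_bad_isCircuit hX hb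
    exact (h C hCX hC).2 hb'
  · push Not at h
    obtain ⟨C, hCX, hC, hb⟩ := h
    exact hB.eRk_of_bad hX (hB.mono hCX (by simpa [hC] using hb))

end LiftFamily

end MatroidLift

/-! ### Closure in frame matroids, and switching thetas and handcuffs to be almost trivial -/

section Frame

variable {α β Γ : Type*} [Group Γ] {G : Graph α β} {ψ : GainFunction G Γ}

theorem frameClosure_subset_edgeSet {X : Set β} : frameClosure ψ X ⊆ G.edgeSet :=
  fun _ ⟨_, _, hl, _⟩ => hl.edge_mem

theorem frameMatroid_indep_iff_notMem_frameClosure {I : Set β} :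
    (frameMatroid ψ).Indep I ↔ I ⊆ G.edgeSet ∧ ∀ e ∈ I, e ∉ frameClosure ψ (I \ {e}) := by
  rw [frameMatroid_indep_iff, no_circuit_iff]

/-- For `f` outside `I`, both sides say that `insert f I` is dependent. If instead some `e ∈ I` is
the spanned element, `frameClosure_exchange` moves the dependency to `f`. -/
theorem Indep.closure_eq_frameClosure {I : Set β} (hI : (frameMatroid ψ).Indep I) :
    (frameMatroid ψ).closure I = frameClosure ψ I := by
  have hI' := frameMatroid_indep_iff_notMem_frameClosure.1 hI
  ext f
  by_cases hfI : f ∈ I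
  · exact iff_of_true ((frameMatroid ψ).mem_closure_of_mem hfI hI.subset_ground)
      (subset_frameClosure hI'.1 hfI)
  by_cases hfE : f ∈ G.edgeSet
  · rw [← not_iff_not, hI.notMem_closure_iff_of_notMem hfI hfE,
      frameMatroid_indep_iff_notMem_frameClosure]
    constructor
    · intro h hf
      exact h.2 f (by simp) (by simpa [hfI] using hf)
    · refine fun h => ⟨Set.insert_subset hfE hI'.1, ?_⟩
      rintro e (rfl | he) hcl
      · exact h (by simpa [hfI] using hcl)
      · have hef : e ≠ f := fun h => hfI (h ▸ he)
        rw [Set.insert_sdiff_of_notMem _ (by simpa using hef.symm)] at hcl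
        have := frameClosure_exchange hfE hcl (hI'.2 e he)
        exact h (by simpa [he] using this)
  · exact iff_of_false (fun h => hfE ((frameMatroid ψ).mem_ground_of_mem_closure h))
      (fun h => hfE (frameClosure_subset_edgeSet h))

theorem frameMatroid_closure_eq {X : Set β} (hX : X ⊆ G.edgeSet) :
    (frameMatroid ψ).closure X = frameClosure ψ X := by
  obtain ⟨I, hI⟩ := (frameMatroid ψ).exists_isBasis X hX
  have h := Indep.closure_eq_frameClosure hI.indep
  rw [← hI.closure_eq_closure, h]
  exact (frameClosure_mono hI.subset).antisymm (frameClosure_idem (h ▸ hI.subset_closure))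

theorem isFrameCircuit_of_isCircuit {C : Set β} (hC : (frameMatroid ψ).IsCircuit C) :
    IsFrameCircuit ψ C := by
  have h := hC.not_indep
  rw [frameMatroid_indep_iff] at h
  push Not at h
  obtain ⟨D, hDC, hD⟩ := h hC.subset_ground
  have hdep : (frameMatroid ψ).Dep D :=
    ⟨fun hi => ((frameMatroid_indep_iff ψ D).1 hi).2 D subset_rfl hD,
      hDC.trans hC.subset_ground⟩
  rwa [← hC.eq_of_dep_subset hdep hDC]

/-- The edges whose gain in each direction lies in `A` after switching by `η`. -/
def switchSet (ψ : GainFunction G Γ) (η : α → Γ) (A : Subgroup Γ) : Set β :=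
  {e | e ∈ G.edgeSet ∧ ∀ u v, G.IsLink e u v → (ψ.switch η).val e u v ∈ A}

theorem switchSet_mono {η : α → Γ} {A A' : Subgroup Γ} (h : A ≤ A') :
    switchSet ψ η A ⊆ switchSet ψ η A' :=
  fun _ he => ⟨he.1, fun u v hl => h (he.2 u v hl)⟩

theorem mem_switchSet_of_isLink {η : α → Γ} {A : Subgroup Γ} {e u v} (hl : G.IsLink e u v)
    (h : (ψ.switch η).val e u v ∈ A) : e ∈ switchSet ψ η A := by
  refine ⟨hl.edge_mem, fun a b hl' => ?_⟩
  rcases hl.eq_and_eq_or_eq_and_eq hl' with ⟨rfl, rfl⟩ | ⟨rfl, rfl⟩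
  · exact h
  · by_cases huv : u = v
    · subst huv; exact h
    · rw [(ψ.switch η).val_symm e u v hl huv]; exact A.inv_mem h

/-- In a union `S` of components on which `η` trivializes the gains, the value of a walk is
determined by its ends. -/
theorem Reach.eq_of_trivial {X : Set β} {S : Set α} {η : α → Γ}
    (hX : ∀ e ∈ X, ∀ u v, G.IsLink e u v → u ∈ S → v ∈ S ∧ (ψ.switch η).val e u v = 1)
    {u v} {k : Γ} (h : Reach ψ X u v k) (hu : u ∈ S) : v ∈ S ∧ k = η u * (η v)⁻¹ := by
  have aux : ∀ {a b c : Γ}, a⁻¹ * b * c = 1 → b = a * c⁻¹ := by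
    intro a b c h
    rw [mul_assoc, inv_mul_eq_one] at h
    rw [h]; group
  induction h with
  | nil u => simpa using hu
  | cons e u v x g he hl _ ih =>
    obtain ⟨hv, h1⟩ := hX e he u v hl hu
    obtain ⟨hx, rfl⟩ := ih hv
    refine ⟨hx, ?_⟩
    rw [aux h1]; group
  | consInv e u v x g he hl _ ih =>
    obtain ⟨hv, -⟩ := hX e he u v hl hu
    obtain ⟨-, h1⟩ := hX e he v u hl.symm hv
    obtain ⟨hx, rfl⟩ := ih hv
    refine ⟨hx, ?_⟩
    rw [aux h1]; group

theorem not_unb_of_trivial {X : Set β} {S : Set α} {η : α → Γ}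
    (hX : ∀ e ∈ X, ∀ u v, G.IsLink e u v → u ∈ S → v ∈ S ∧ (ψ.switch η).val e u v = 1)
    {u} (hu : u ∈ S) : ¬ Unb ψ X u := by
  rintro ⟨g, hg, h⟩
  exact hg (by simpa using (h.eq_of_trivial hX hu).2)

/-- A path can be trivialized by changing the switching function on all its vertices except
its end. -/
theorem IsPath.exists_switch {Γ' : Type*} [Group Γ'] {ψ' : GainFunction G Γ'} {u v P W} {g : Γ'}
    (h : IsPath ψ' u v P W g) (ψ : GainFunction G Γ) (η : α → Γ) :
    ∃ η' : α → Γ, (∀ x, (x ∈ W → x = v) → η' x = η x) ∧ P ⊆ switchSet ψ η' ⊥ := by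
  classical
  induction h with
  | nil u hu => exact ⟨η, fun _ _ => rfl, by simp⟩
  | cons e u v x P W g hl hp hu ih =>
    obtain ⟨η', h1, h2⟩ := ih
    have hvu : v ≠ u := fun h => hu (h ▸ hp.left_mem)
    -- The value at `u` is the one that makes the gain of `e` from `u` to `v` equal to `1` after
    -- switching.
    refine ⟨Function.update η' u (ψ.val e u v * η' v), ?_, ?_⟩
    · intro y hy
      have hyu : y ≠ u := by
        rintro rfl
        exact hu (hy (by simp) ▸ hp.right_mem)
      rw [Function.update_of_ne hyu]
      exact h1 y fun h => hy (Or.inr h)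
    · rintro f (rfl | hf)
      · refine mem_switchSet_of_isLink hl ?_
        simp [GainFunction.switch, Function.update_of_ne hvu]
      · refine ⟨(h2 hf).1, fun a b hab => ?_⟩
        obtain ⟨ha, hb, -⟩ := hp.ends hf hab
        have := (h2 hf).2 a b hab
        have ha' : a ≠ u := fun h => hu (h ▸ ha)
        have hb' : b ≠ u := fun h => hu (h ▸ hb)
        simpa [GainFunction.switch, Function.update_of_ne ha', Function.update_of_ne hb'] using this

/-- The edges of `R` have their ends in `W` and are trivialized by a switching function. -/
def IsTrivializable (ψ : GainFunction G Γ) (R : Set β) (W : Set α) : Prop :=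
  (∃ η, R ⊆ switchSet ψ η ⊥) ∧ ∀ e ∈ R, ∀ a b, G.IsLink e a b → a ∈ W

theorem isTrivializable_empty : IsTrivializable ψ ∅ ∅ := ⟨⟨1, by simp⟩, by simp⟩

/-- A path that touches the earlier vertices `W₀` at most in its end `v` can be trivialized by
changing the switching function only off `W₀`, which keeps the edges of `R` trivial. Trees are built
by attaching such paths. -/
theorem IsTrivializable.union {Γ' : Type*} [Group Γ'] {ψ' : GainFunction G Γ'} {R W₀ u v P W}
    {g : Γ'} (hR : IsTrivializable ψ R W₀) (h : IsPath ψ' u v P W g)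
    (hW : ∀ y ∈ W, y ∈ W₀ → y = v) : IsTrivializable ψ (R ∪ P) (W₀ ∪ W) := by
  obtain ⟨⟨η, hη⟩, hR⟩ := hR
  obtain ⟨η', h1, h2⟩ := h.exists_switch ψ η
  refine ⟨⟨η', Set.union_subset (fun e he => ⟨(hη he).1, fun a b hl => ?_⟩) h2⟩, ?_⟩
  · have := (hη he).2 a b hl
    have ha := h1 a fun h => hW a h (hR e he a b hl)
    have hb := h1 b fun h => hW b h (hR e he b a hl.symm)
    simpa [GainFunction.switch, ha, hb] using this
  · rintro e (he | he) a b hl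
    · exact Or.inl (hR e he a b hl)
    · exact Or.inr (h.ends he hl).1

/-- `X` consists of two edges and a set `R` that is trivialized by a switching function and joins
the ends of both edges. -/
def HasTrivialCore {Γ' : Type*} [Group Γ'] (ψ' : GainFunction G Γ') (ψ : GainFunction G Γ)
    (X : Set β) : Prop :=
  ∃ R f₁ f₂ W, X = insert f₁ (insert f₂ R) ∧ f₁ ∉ insert f₂ R ∧ f₂ ∉ R ∧
    IsTrivializable ψ R W ∧ (∃ u v k, G.IsLink f₁ u v ∧ Reach ψ' R u v k) ∧
    ∃ u v k, G.IsLink f₂ u v ∧ Reach ψ' R u v k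

/-- Deleting the edges at `u` of two of the three paths leaves a tree made of three paths ending in
`v`; the ends of both deleted edges are joined through `v`. -/
theorem IsTheta.hasTrivialCore {Γ' : Type*} [Group Γ'] {ψ' : GainFunction G Γ'} {X : Set β}
    (h : IsTheta ψ' X) : HasTrivialCore ψ' ψ X := by
  obtain ⟨u, v, P₁, P₂, P₃, W₁, W₂, W₃, g₁, g₂, g₃, huv, h1, h2, h3, d12, d13, d23, w12, w13,
    w23, rfl⟩ := h
  cases h1 with
  | nil => exact absurd rfl huv
  | cons e₁ _ w₁ _ Q₁ V₁ k₁ l₁ q₁ hu₁ =>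
  cases h2 with
  | nil => exact absurd rfl huv
  | cons e₂ _ w₂ _ Q₂ V₂ k₂ l₂ q₂ hu₂ =>
  have n₁ : e₁ ∉ Q₁ := fun h => hu₁ (q₁.ends h l₁).1
  have n₂ : e₂ ∉ Q₂ := fun h => hu₂ (q₂.ends h l₂).1
  have t : IsTrivializable ψ (∅ ∪ Q₁ ∪ Q₂ ∪ P₃) (∅ ∪ V₁ ∪ V₂ ∪ W₃) := by
    refine ((isTrivializable_empty.union q₁ (by simp)).union q₂ ?_).union h3 ?_
    · intro y hy hy'
      have : y ∈ insert u V₁ ∩ insert u V₂ :=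
        ⟨Or.inr (by simpa using hy'), Or.inr hy⟩
      rw [w12] at this
      rcases this with rfl | h
      · exact absurd hy hu₂
      · exact h
    · rintro y hy ((hy' | hy') | hy')
      · exact hy'.elim
      · have : y ∈ insert u V₁ ∩ W₃ := ⟨Or.inr hy', hy⟩
        rw [w13] at this
        rcases this with rfl | h
        · exact absurd hy' hu₁
        · exact h
      · have : y ∈ insert u V₂ ∩ W₃ := ⟨Or.inr hy', hy⟩
        rw [w23] at this
        rcases this with rfl | h
        · exact absurd hy' hu₂
        · exact h
  rw [Set.empty_union] at t
  refine ⟨Q₁ ∪ Q₂ ∪ P₃, e₁, e₂, _, by grind, by grind, by grind, t,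
    ⟨u, w₁, _, l₁, (h3.reach (by grind)).trans (q₁.reach (by grind)).symm⟩,
    ⟨u, w₂, _, l₂, (h3.reach (by grind)).trans (q₂.reach (by grind)).symm⟩⟩

/-- Deleting one edge leaves two paths that end in the chosen vertex `x`, the form in which
`IsTrivializable.union` attaches them. For a loop both paths are empty. -/
theorem IsCycle.split {C W} {g : Γ} (h : IsCycle ψ C W g) {x} (hx : x ∈ W) :
    ∃ e a b A V B V' k k', C = insert e (A ∪ B) ∧ e ∉ A ∪ B ∧ G.IsLink e a b ∧
      IsPath ψ a x A V k ∧ IsPath ψ b x B V' k' ∧ W = V ∪ V' ∧ ∀ y ∈ V, y ∈ V' → y = x := by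
  cases h with
  | mk e u v P _ g hl hp he =>
    obtain ⟨P₁, W₁, g₁, P₂, W₂, g₂, h1, h2, rfl, rfl, h3, -⟩ := hp.split hx
    exact ⟨e, v, u, P₁, W₁, P₂, W₂, _, _, rfl, he, hl.symm, h1, h2.reverse, rfl, h3⟩

theorem IsCycle.exists_isLink {C W} {g : Γ} (h : IsCycle ψ C W g) {e} (he : e ∈ C) :
    ∃ a b, G.IsLink e a b := by
  cases h with
  | mk e' u v P _ g hl hp he' =>
    rcases he with rfl | he
    · exact ⟨_, _, hl⟩
    · exact Graph.exists_isLink_of_mem_edgeSet (hp.subset_edgeSet he)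

/-- Deleting one edge from each cycle leaves four paths that end in the common vertex. -/
theorem hasTrivialCore_of_tight {Γ' : Type*} [Group Γ'] {ψ' : GainFunction G Γ'}
    {X : Set β} (h : IsUnbalancedTightHandcuff ψ' X) : HasTrivialCore ψ' ψ X := by
  obtain ⟨C₁, C₂, W₁, W₂, x, ⟨⟨g, h1⟩, -⟩, ⟨⟨g', h2⟩, -⟩, hd, hW, rfl⟩ := h
  have hx : x ∈ W₁ ∩ W₂ := by rw [hW]; rfl
  obtain ⟨e, a, b, A, V, B, V', k, k', rfl, he, hl, hA, hB, rfl, hV⟩ := h1.split hx.1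
  obtain ⟨e₂, a₂, b₂, A₂, V₂, B₂, V₂', k₂, k₂', rfl, he₂, hl₂, hA₂, hB₂, rfl, hV₂⟩ :=
    h2.split hx.2
  have hWx : ∀ y, (y ∈ V ∨ y ∈ V') → (y ∈ V₂ ∨ y ∈ V₂') → y = x := fun y h1 h2 => by
    have : y ∈ (V ∪ V') ∩ (V₂ ∪ V₂') := ⟨h1, h2⟩
    rw [hW] at this; exact this
  have t := (((isTrivializable_empty (ψ := ψ)).union hA (by simp)).union hB (by grind)).union
    hA₂ (by grind) |>.union hB₂ (by grind)
  rw [Set.empty_union] at t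
  refine ⟨_, e, e₂, _, ?_, ?_, ?_, t,
    ⟨a, b, _, hl, (hA.reach (by grind)).trans (hB.reach (by grind)).symm⟩,
    ⟨a₂, b₂, _, hl₂, (hA₂.reach (by grind)).trans (hB₂.reach (by grind)).symm⟩⟩
  · grind
  · rw [Set.disjoint_left] at hd; grind
  · rw [Set.disjoint_left] at hd; grind

theorem hasTrivialCore_of_loose {Γ' : Type*} [Group Γ'] {ψ' : GainFunction G Γ'}
    {X : Set β} (h : IsUnbalancedLooseHandcuff ψ' X) : HasTrivialCore ψ' ψ X := by
  obtain ⟨C₁, C₂, P, W₁, W₂, W, u, v, k₀, ⟨⟨g, h1⟩, -⟩, ⟨⟨g', h2⟩, -⟩, hP, hW, hu, hv, rfl⟩ := h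
  have hu' : u ∈ W ∩ W₁ := by rw [hu]; rfl
  have hv' : v ∈ W ∩ W₂ := by rw [hv]; rfl
  have hWu : ∀ y ∈ W, y ∈ W₁ → y = u := fun y h1 h2 => by
    have : y ∈ W ∩ W₁ := ⟨h1, h2⟩
    rw [hu] at this; exact this
  have hWv : ∀ y ∈ W, y ∈ W₂ → y = v := fun y h1 h2 => by
    have : y ∈ W ∩ W₂ := ⟨h1, h2⟩
    rw [hv] at this; exact this
  have hWW : ∀ y ∈ W₁, y ∉ W₂ := fun y h1 h2 => by
    have : y ∈ W₁ ∩ W₂ := ⟨h1, h2⟩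
    rw [hW] at this; exact this
  have d12 : ∀ f ∈ C₁, f ∉ C₂ := fun f hf hf' => by
    obtain ⟨a, b, hl⟩ := h1.exists_isLink hf
    exact hWW a (h1.ends hf hl).1 (h2.ends hf' hl).1
  have d1 : ∀ f ∈ C₁, f ∉ P := fun f hf hf' => by
    obtain ⟨a, b, hl, ha, hb, hab⟩ := hP.exists_link hf'
    exact hab ((hWu a ha (h1.ends hf hl).1).trans (hWu b hb (h1.ends hf hl).2).symm)
  have d2 : ∀ f ∈ C₂, f ∉ P := fun f hf hf' => by
    obtain ⟨a, b, hl, ha, hb, hab⟩ := hP.exists_link hf'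
    exact hab ((hWv a ha (h2.ends hf hl).1).trans (hWv b hb (h2.ends hf hl).2).symm)
  obtain ⟨e, a, b, A, V, B, V', k, k', rfl, he, hl, hA, hB, rfl, hV⟩ := h1.split hu'.2
  obtain ⟨e₂, a₂, b₂, A₂, V₂, B₂, V₂', k₂, k₂', rfl, he₂, hl₂, hA₂, hB₂, rfl, hV₂⟩ :=
    h2.split hv'.2
  -- The path `P` is reversed so that its end is `u`, where it is attached to the first cycle; the
  -- paths of the second cycle are then attached at `v`.
  have t := ((((isTrivializable_empty (ψ := ψ)).union hA (by simp)).union hB (by grind)).union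
    hP.reverse (by grind)).union hA₂ (by grind) |>.union hB₂ (by grind)
  rw [Set.empty_union] at t
  refine ⟨_, e, e₂, _, ?_, ?_, ?_, t,
    ⟨a, b, _, hl, (hA.reach (by grind)).trans (hB.reach (by grind)).symm⟩,
    ⟨a₂, b₂, _, hl₂, (hA₂.reach (by grind)).trans (hB₂.reach (by grind)).symm⟩⟩
  · grind
  · grind
  · grind

variable {Γ₁ : Subgroup Γ} [Γ₁.Normal]

/-- Modulo `Γ₁`, the value of every walk in `R` is determined by `η` at its ends, and an edge whose
switched gain is in `Γ₁` has that same value, so a walk in `R` joining its ends spans it. -/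
theorem mem_frameClosure_quotient {R : Set β} {η : α → Γ} (hR : R ⊆ switchSet ψ η ⊥) {f u v k}
    (hl : G.IsLink f u v) (hk : Reach (ψ.quotient Γ₁) R u v k) (hf : f ∈ switchSet ψ η Γ₁) :
    f ∈ frameClosure (ψ.quotient Γ₁) R := by
  refine ⟨u, v, hl, Or.inl ?_⟩
  have h := (hk.eq_of_trivial (S := Set.univ) (η := fun x => (η x : Γ ⧸ Γ₁)) (fun e he a b hab _ =>
    ⟨trivial, ?_⟩) trivial).2
  · convert hk using 1
    rw [h]
    have := (QuotientGroup.eq_one_iff (N := Γ₁) _).2 (hf.2 u v hl)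
    have h2 : ((η u)⁻¹ * ψ.val f u v * η v : Γ) = ((1 : Γ) : Γ ⧸ Γ₁) := this
    have h3 : (ψ.val f u v : Γ ⧸ Γ₁) = (η u * ((η u)⁻¹ * ψ.val f u v * η v) * (η v)⁻¹ : Γ) := by
      congr 1; group
    change (ψ.val f u v : Γ ⧸ Γ₁) = _
    rw [h3, QuotientGroup.mk_mul, QuotientGroup.mk_mul, h2]
    simp
  · have := (hR he).2 a b hab
    rw [Subgroup.mem_bot] at this
    exact congrArg (QuotientGroup.mk (s := Γ₁)) this

/-- A theta graph or handcuff that is a circuit of the frame matroid is, up to two edges, trivial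
after switching, and the two edges have gains outside `Γ₁`. -/
theorem exists_switch_of_isCircuit {C : Set β}
    (hC : (frameMatroid (ψ.quotient Γ₁)).IsCircuit C)
    (h : IsUnbalancedTheta (ψ.quotient Γ₁) C ∨ IsUnbalancedTightHandcuff (ψ.quotient Γ₁) C ∨
      IsUnbalancedLooseHandcuff (ψ.quotient Γ₁) C) :
    ∃ (η : α → Γ) (R : Set β) (f₁ f₂ : β), C = insert f₁ (insert f₂ R) ∧ f₁ ∉ insert f₂ R ∧
      R ⊆ switchSet ψ η ⊥ ∧ f₁ ∉ switchSet ψ η Γ₁ ∧ f₂ ∉ switchSet ψ η Γ₁ := by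
  obtain ⟨R, f₁, f₂, W, rfl, hf₁, hf₂, ⟨⟨η, hη⟩, -⟩, ⟨u, v, k, hl, hk⟩, ⟨u', v', k', hl', hk'⟩⟩ :
      HasTrivialCore (ψ.quotient Γ₁) ψ C := by
    rcases h with h | h | h
    · exact h.1.hasTrivialCore
    · exact hasTrivialCore_of_tight h
    · exact hasTrivialCore_of_loose h
  -- A circuit minus one of the two special edges is independent, so the other one is not spanned by
  -- `R`.
  have key : ∀ f, insert f R ⊂ insert f₁ (insert f₂ R) → f ∉ R →
      f ∉ frameClosure (ψ.quotient Γ₁) R := by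
    intro f hs hfR hf
    have := (frameMatroid_indep_iff_notMem_frameClosure.1 (hC.ssubset_indep hs)).2 f (by simp)
    exact this (by simpa [hfR] using hf)
  refine ⟨η, R, f₁, f₂, rfl, hf₁, hη, fun h => ?_, fun h => ?_⟩
  · refine key f₁ ⟨by grind, fun h => ?_⟩ (by grind) (mem_frameClosure_quotient hη hl hk h)
    have := h (show f₂ ∈ insert f₁ (insert f₂ R) by simp)
    grind
  · refine key f₂ ⟨by grind, fun h => ?_⟩ (by grind) (mem_frameClosure_quotient hη hl' hk' h)
    have := h (show f₁ ∈ insert f₁ (insert f₂ R) by simp)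
    grind

theorem IsPath.of_quotient {u v P W} {g : Γ ⧸ Γ₁} (h : IsPath (ψ.quotient Γ₁) u v P W g) :
    ∃ k, IsPath ψ u v P W k := by
  induction h with
  | nil u hu => exact ⟨_, .nil u hu⟩
  | cons e u v x P W g hl hp hu ih =>
    obtain ⟨k, hk⟩ := ih
    exact ⟨_, .cons e u v x P W k hl hk hu⟩

/-- A cycle of the quotient gain graph is a cycle of the gain graph. -/
theorem IsCycle.of_quotient {C W} {g : Γ ⧸ Γ₁} (h : IsCycle (ψ.quotient Γ₁) C W g) :
    ∃ k, IsCycle ψ C W k := by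
  cases h with
  | mk e u v P _ g hl hp he =>
    obtain ⟨k, hk⟩ := hp.of_quotient
    exact ⟨_, .mk e u v P _ k hl hk he⟩

end Frame

/-! ### Edges spanned by trivial edges -/

section Trivial

variable {α β Γ : Type*} [Group Γ] {G : Graph α β} {ψ : GainFunction G Γ}

/-- No vertex of `S` is unbalanced, so a spanned edge at `S` comes from a walk. Only `S` is assumed
to be trivialized: `X` may have unbalanced components elsewhere. -/
theorem eq_one_of_mem_frameClosure {X : Set β} {S : Set α} {η : α → Γ}
    (hX : ∀ e ∈ X, ∀ u v, G.IsLink e u v → u ∈ S → v ∈ S ∧ (ψ.switch η).val e u v = 1)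
    {f u v} (hl : G.IsLink f u v) (hu : u ∈ S) (hf : f ∈ frameClosure ψ X) :
    v ∈ S ∧ (ψ.switch η).val f u v = 1 := by
  rcases spanned_of_mem_closure hf hl with h | h
  · obtain ⟨hv, hk⟩ := h.eq_of_trivial hX hu
    refine ⟨hv, ?_⟩
    simp [GainFunction.switch, hk]
  · exact absurd h.1 (not_unb_of_trivial hX hu)

theorem frameClosure_subset_switchSet {X : Set β} {η : α → Γ} (hX : X ⊆ switchSet ψ η ⊥) :
    frameClosure ψ X ⊆ switchSet ψ η ⊥ := fun _ hf =>
  ⟨frameClosure_subset_edgeSet hf, fun _ _ hl => (eq_one_of_mem_frameClosure (S := Set.univ)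
    (fun _ he a b hab _ => ⟨trivial, (hX he).2 a b hab⟩) hl trivial hf).2⟩

theorem mem_switchSet_quotient {Γ₁ : Subgroup Γ} [Γ₁.Normal] {η : α → Γ} {f : β} :
    f ∈ switchSet (ψ.quotient Γ₁) (fun x => (η x : Γ ⧸ Γ₁)) ⊥ ↔ f ∈ switchSet ψ η Γ₁ := by
  refine and_congr_right fun _ => forall₂_congr fun u v => imp_congr_right fun _ => ?_
  rw [Subgroup.mem_bot]
  exact QuotientGroup.eq_one_iff (N := Γ₁) ((η u)⁻¹ * ψ.val f u v * η v)

/-- Having gains in `Γ₁` is being trivial over `Γ/Γ₁`, and trivial edges span only trivial edges. -/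
theorem frameClosure_quotient_subset {Γ₁ : Subgroup Γ} [Γ₁.Normal] {X : Set β} {η : α → Γ}
    (hX : X ⊆ switchSet ψ η ⊥) : frameClosure (ψ.quotient Γ₁) X ⊆ switchSet ψ η Γ₁ :=
  fun _ hf => mem_switchSet_quotient.1 (frameClosure_subset_switchSet
    (fun _ he => mem_switchSet_quotient.2 (switchSet_mono bot_le (hX he))) hf)

end Trivial

/-! ### Edges, triangles and parallel pairs of the complete gain graph -/

section Complete

variable {n : ℕ} {Γ : Type*}

theorem completeGraph_ne {e : CompleteEdge n Γ} {i j : Fin n}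
    (hl : (completeGraph n Γ).IsLink e i j) : i ≠ j := by
  have := e.1.2
  rcases hl with ⟨rfl, rfl⟩ | ⟨rfl, rfl⟩
  · exact this.ne
  · exact this.ne'

theorem mem_completeGraph_edgeSet (e : CompleteEdge n Γ) : e ∈ (completeGraph n Γ).edgeSet :=
  Graph.IsLink.edge_mem (x := e.1.1.1) (y := e.1.1.2) (Or.inl ⟨rfl, rfl⟩)

variable [Group Γ]

/-- The edge between `i` and `j` that has gain `g` from `i` to `j` after switching by `η`. -/
def arc {i j : Fin n} (h : i ≠ j) (η : Fin n → Γ) (g : Γ) : CompleteEdge n Γ :=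
  if hlt : i < j then (⟨(i, j), hlt⟩, η i * g * (η j)⁻¹)
  else (⟨(j, i), h.symm.lt_of_le (not_lt.1 hlt)⟩, (η i * g * (η j)⁻¹)⁻¹)

theorem isLink_arc {i j : Fin n} (h : i ≠ j) (η : Fin n → Γ) (g : Γ) :
    (completeGraph n Γ).IsLink (arc h η g) i j := by
  unfold arc completeGraph
  split_ifs <;> simp

theorem val_arc {i j : Fin n} (h : i ≠ j) (η : Fin n → Γ) (g : Γ) :
    (completeGain n Γ).val (arc h η g) i j = η i * g * (η j)⁻¹ := by
  by_cases hlt : i < j <;> simp [arc, completeGain, hlt]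

theorem switch_val_arc {i j : Fin n} (h : i ≠ j) (η : Fin n → Γ) (g : Γ) :
    ((completeGain n Γ).switch η).val (arc h η g) i j = g := by
  simp only [GainFunction.switch, val_arc]
  group

theorem eq_of_val_eq {e f : CompleteEdge n Γ} {i j : Fin n}
    (he : (completeGraph n Γ).IsLink e i j) (hf : (completeGraph n Γ).IsLink f i j)
    (h : (completeGain n Γ).val e i j = (completeGain n Γ).val f i j) : e = f := by
  obtain ⟨⟨⟨a, b⟩, hab⟩, x⟩ := e
  obtain ⟨⟨⟨c, d⟩, hcd⟩, y⟩ := f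
  simp only [completeGraph] at he hf
  simp only [completeGain] at h
  have hab' : a < b := hab
  have hcd' : c < d := hcd
  rcases he with ⟨rfl, rfl⟩ | ⟨rfl, rfl⟩ <;> rcases hf with ⟨rfl, rfl⟩ | ⟨rfl, rfl⟩
  · rw [if_pos hab', if_pos hab'] at h
    rw [h]
  · exact absurd hab' hcd'.asymm
  · exact absurd hab' hcd'.asymm
  · rw [if_neg hab'.asymm, if_neg hab'.asymm, inv_inj] at h
    rw [h]

theorem eq_arc {e : CompleteEdge n Γ} {i j : Fin n} (hl : (completeGraph n Γ).IsLink e i j)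
    (η : Fin n → Γ) :
    e = arc (completeGraph_ne hl) η (((completeGain n Γ).switch η).val e i j) := by
  refine eq_of_val_eq hl (isLink_arc _ _ _) ?_
  rw [val_arc]
  simp only [GainFunction.switch]
  group

theorem arc_eq_arc {i j : Fin n} (h : i ≠ j) {η η' : Fin n → Γ} {g g' : Γ}
    (hg : η i * g * (η j)⁻¹ = η' i * g' * (η' j)⁻¹) : arc h η g = arc h η' g' :=
  eq_of_val_eq (isLink_arc _ _ _) (isLink_arc _ _ _) (by rw [val_arc, val_arc, hg])

theorem arc_symm {i j : Fin n} (h : i ≠ j) (η : Fin n → Γ) (g : Γ) :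
    arc h.symm η g⁻¹ = arc h η g := by
  refine eq_of_val_eq (isLink_arc _ _ _).symm (isLink_arc _ _ _) ?_
  rw [(completeGain n Γ).val_symm _ _ _ (isLink_arc _ _ _) h.symm, val_arc, val_arc]
  group

theorem arc_mem_switchSet {i j : Fin n} (h : i ≠ j) {η : Fin n → Γ} {g : Γ} {A : Subgroup Γ} :
    arc h η g ∈ switchSet (completeGain n Γ) η A ↔ g ∈ A := by
  constructor
  · intro hg
    have := hg.2 i j (isLink_arc h η g)
    rwa [switch_val_arc] at this
  · intro hg
    refine mem_switchSet_of_isLink (isLink_arc h η g) ?_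
    rwa [switch_val_arc]

theorem mem_switchSet_iff_exists_arc {e : CompleteEdge n Γ} {η : Fin n → Γ} {A : Subgroup Γ} :
    e ∈ switchSet (completeGain n Γ) η A ↔ ∃ i j, ∃ h : i ≠ j, ∃ g ∈ A, e = arc h η g := by
  constructor
  · rintro ⟨he, h⟩
    obtain ⟨u, v, hl⟩ := Graph.exists_isLink_of_mem_edgeSet he
    exact ⟨u, v, completeGraph_ne hl, _, h u v hl, eq_arc hl η⟩
  · rintro ⟨i, j, h, g, hg, rfl⟩
    exact (arc_mem_switchSet h).2 hg

theorem isCycle_triangle {i j k : Fin n} (hij : i ≠ j) (hjk : j ≠ k) (hik : i ≠ k)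
    (η : Fin n → Γ) (g h : Γ) : ∃ W, IsCycle (completeGain n Γ)
      (insert (arc hik η (g * h)) {arc hij η g, arc hjk η h}) W 1 := by
  have lij := isLink_arc hij η g
  have ljk := isLink_arc hjk η h
  have lik := isLink_arc hik η (g * h)
  have hp := IsPath.cons (ψ := completeGain n Γ) _ i j k _ _ _ lij
    (IsPath.single ljk hjk) (by simp [hij, hik])
  -- The closed walk starts with the third edge, backwards from `k` to `i`, and returns along `i`,
  -- `j`, `k`.
  have hc := IsCycle.mk (ψ := completeGain n Γ) _ k i _ _ _ lik.symm hp ?_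
  · refine ⟨{i, j, k}, ?_⟩
    convert hc using 1
    rw [(completeGain n Γ).val_symm _ _ _ lik hik, val_arc, val_arc, val_arc]
    group
  · rintro (h | h)
    · rw [h] at lik
      exact hjk (lij.right_unique lik)
    · rw [Set.mem_singleton_iff] at h
      rw [h] at lik
      exact hij (lik.left_unique ljk)

theorem isCycle_pair {i j : Fin n} (hij : i ≠ j) (η : Fin n → Γ) {g h : Γ} (hgh : g ≠ h) :
    ∃ W k, IsCycle (completeGain n Γ) {arc hij η g, arc hij η h} W k := by
  refine ⟨_, _, IsCycle.mk _ i j _ _ _ (isLink_arc hij η g)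
    (IsPath.single (isLink_arc hij η h).symm hij.symm) ?_⟩
  intro he
  have := congrArg (fun e => ((completeGain n Γ).switch η).val e i j) he
  simp only [switch_val_arc] at this
  exact hgh this

/-- Some switching function makes the edge of gain `h` trivial, hence everything spanned by it; a
parallel edge that is also trivial has the same gain. -/
theorem arc_notMem_frameClosure {i j : Fin n} (hij : i ≠ j) (η : Fin n → Γ) {g h : Γ}
    (hgh : g ≠ h) : arc hij η g ∉ frameClosure (completeGain n Γ) {arc hij η h} := by
  intro hf
  obtain ⟨η', -, h1⟩ := (IsPath.single (ψ := completeGain n Γ)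
    (isLink_arc hij η h) hij).exists_switch (completeGain n Γ) η
  have h2 := (frameClosure_subset_switchSet h1 hf).2 i j (isLink_arc hij η g)
  have h3 := (h1 rfl).2 i j (isLink_arc hij η h)
  rw [Subgroup.mem_bot] at h2 h3
  have := h2.trans h3.symm
  simp only [GainFunction.switch, val_arc] at this
  simp at this
  exact hgh this

theorem not_isBalancedCycle_pair {i j : Fin n} (hij : i ≠ j) (η : Fin n → Γ) {g h : Γ}
    (hgh : g ≠ h) : ¬ IsBalancedCycle (completeGain n Γ) {arc hij η g, arc hij η h} := by
  intro hb
  obtain ⟨e, he, hcl⟩ := IsFrameCircuit.exists_mem_closure (Or.inl hb)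
  rcases he with rfl | he
  · exact arc_notMem_frameClosure hij η hgh (frameClosure_mono (by simp) hcl)
  · rw [Set.mem_singleton_iff] at he
    subst he
    refine arc_notMem_frameClosure hij η hgh.symm (frameClosure_mono ?_ hcl)
    rintro x ⟨rfl | hx, hx'⟩
    · rfl
    · exact absurd hx hx'

end Complete

/-! ### Lifts over the complete gain graph: the flat of trivial edges -/

section Complete

variable {n : ℕ} {Γ : Type*} [Group Γ]

/-- `M` is an elementary lift, with family `B`, of the frame matroid of the complete `Γ`-gain graph
over `Γ/Γ₁`, and the balanced cycles are the cycles that are circuits of `M`. -/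
structure IsCompleteLift (Γ₁ : Subgroup Γ) [Γ₁.Normal] (M : Matroid (CompleteEdge n Γ))
    (B : Set (CompleteEdge n Γ) → Prop) : Prop where
  lift : LiftFamily M (frameMatroid ((completeGain n Γ).quotient Γ₁)) B
  isCircuit_iff : ∀ C W g, IsCycle (completeGain n Γ) C W g →
    (M.IsCircuit C ↔ IsBalancedCycle (completeGain n Γ) C)

variable {Γ₁ : Subgroup Γ} [Γ₁.Normal] {M : Matroid (CompleteEdge n Γ)}
  {B : Set (CompleteEdge n Γ) → Prop}

theorem frameMatroid_completeGraph_closure (X : Set (CompleteEdge n Γ)) :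
    (frameMatroid ((completeGain n Γ).quotient Γ₁)).closure X =
      frameClosure ((completeGain n Γ).quotient Γ₁) X :=
  frameMatroid_closure_eq fun e _ => mem_completeGraph_edgeSet e

namespace IsCompleteLift

variable (H : IsCompleteLift Γ₁ M B)

include H

theorem subset_ground (X : Set (CompleteEdge n Γ)) : X ⊆ M.E := fun e _ => by
  rw [H.lift.ground_eq]; exact mem_completeGraph_edgeSet e

theorem subset_closure (X : Set (CompleteEdge n Γ)) : X ⊆ M.closure X :=
  M.subset_closure X (H.subset_ground X)

theorem mem_frameClosure {X : Set (CompleteEdge n Γ)} {e} (he : e ∈ M.closure X) :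
    e ∈ frameClosure ((completeGain n Γ).quotient Γ₁) X := by
  rw [← frameMatroid_completeGraph_closure]
  exact H.lift.closure_subset X he

/-- The balanced triangle is a circuit of `M`. Spanning statements in `M` are built from this step.
-/
theorem triangle_mem {i j k : Fin n} (hij : i ≠ j) (hjk : j ≠ k) (hik : i ≠ k)
    {η : Fin n → Γ} {g h : Γ} {X : Set (CompleteEdge n Γ)} (h₁ : arc hij η g ∈ M.closure X)
    (h₂ : arc hjk η h ∈ M.closure X) : arc hik η (g * h) ∈ M.closure X := by
  obtain ⟨W, hW⟩ := isCycle_triangle hij hjk hik η g h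
  have hc := (H.isCircuit_iff _ _ _ hW).2 ⟨W, hW⟩
  have := hc.mem_closure_sdiff_singleton_of_mem (e := arc hik η (g * h)) (by simp)
  refine M.closure_subset_closure_of_subset_closure ?_ this
  rintro e ⟨rfl | rfl | rfl, he⟩
  · exact absurd rfl he
  · exact h₁
  · exact h₂

theorem isNonloop (e : CompleteEdge n Γ) : M.IsNonloop e := by
  rw [← Matroid.indep_singleton]
  refine H.lift.indep (frameMatroid_indep_iff_notMem_frameClosure.2
    ⟨fun e _ => mem_completeGraph_edgeSet e, ?_⟩)
  rintro f rfl hf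
  obtain ⟨i, j, hl⟩ := Graph.exists_isLink_of_mem_edgeSet (mem_completeGraph_edgeSet f)
  have : f ∈ frameClosure ((completeGain n Γ).quotient Γ₁) ∅ :=
    by simpa using hf
  -- With no edges available, `{i}` is a balanced component, so a spanned edge at `i` would be a
  -- loop.
  exact completeGraph_ne hl (eq_one_of_mem_frameClosure (S := {i}) (η := 1) (by simp) hl rfl
    this).1.symm

/-- Otherwise the two parallel edges form a circuit of `M`, and this cycle would have to be
balanced. -/
theorem arc_notMem_closure_singleton {i j : Fin n} (hij : i ≠ j) (η : Fin n → Γ) {g h : Γ}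
    (hgh : g ≠ h) : arc hij η g ∉ M.closure {arc hij η h} := by
  intro hcl
  have hne : arc hij η g ≠ arc hij η h := fun he =>
    arc_notMem_frameClosure hij η hgh (he ▸ subset_frameClosure
      (fun e _ => mem_completeGraph_edgeSet e) rfl)
  obtain ⟨C, hCs, hC, hgC⟩ := (Matroid.mem_closure_iff_exists_isCircuit (by simpa)).1 hcl
  have hhC : arc hij η h ∈ C := by
    by_contra hh
    have hsub : C ⊆ {arc hij η g} := fun x hx => by
      rcases hCs hx with rfl | rfl
      · rfl
      · exact absurd hx hh
    exact hC.not_indep ((Matroid.indep_singleton.2 (H.isNonloop _)).subset hsub)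
  have hC' : C = {arc hij η g, arc hij η h} :=
    hCs.antisymm (Set.insert_subset hgC (by simpa))
  obtain ⟨W, k, hW⟩ := isCycle_pair hij η hgh
  exact not_isBalancedCycle_pair hij η hgh ((H.isCircuit_iff _ _ _ hW).1 (hC' ▸ hC))

/-- Balanced triangles shortcut the walk one edge at a time. -/
theorem arc_one_mem_closure_of_reach {R : Set (CompleteEdge n Γ)} {η : Fin n → Γ}
    (hR : R ⊆ switchSet (completeGain n Γ) η ⊥) {u v k}
    (h : Reach ((completeGain n Γ).quotient Γ₁) R u v k) (huv : u ≠ v) :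
    arc huv η 1 ∈ M.closure R := by
  have step : ∀ {e u v x} (_ : e ∈ R) (_ : (completeGraph n Γ).IsLink e u v)
      (_ : ∀ h : v ≠ x, arc h η 1 ∈ M.closure R) (h : u ≠ x), arc h η 1 ∈ M.closure R := by
    intro e u v x he hl ih hux
    have he' : arc (completeGraph_ne hl) η 1 ∈ M.closure R := by
      have h1 := (hR he).2 u v hl
      rw [Subgroup.mem_bot] at h1
      have h2 := eq_arc hl η
      rw [h1] at h2
      exact h2 ▸ H.subset_closure R he
    by_cases hvx : v = x
    · subst hvx; exact he'
    · simpa using H.triangle_mem _ _ hux he' (ih hvx)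
  induction h with
  | nil u => exact absurd rfl huv
  | cons e u v x g he hl _ ih => exact step he hl ih huv
  | consInv e u v x g he hl _ ih => exact step he hl ih huv

/-- The trivial edges have the same rank in `M` as in the frame matroid. -/
theorem not_bad_trivial (η : Fin n → Γ) : ¬ B (switchSet (completeGain n Γ) η ⊥) := by
  intro hb
  set N := frameMatroid ((completeGain n Γ).quotient Γ₁)
  obtain ⟨I, hI⟩ := N.exists_isBasis (switchSet (completeGain n Γ) η ⊥)
    (fun e _ => mem_completeGraph_edgeSet e)
  -- An `N`-basis of the trivial edges spans them in `M` as well, through walks in the basis, so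
  -- badness would pass to an `N`-independent set.
  refine H.lift.not_bad hI.indep (H.lift.bad_of_subset_closure hb fun e he => ?_)
  obtain ⟨i, j, hij, g, hg, rfl⟩ := mem_switchSet_iff_exists_arc.1 he
  obtain rfl := Subgroup.mem_bot.1 hg
  have hcl := hI.subset_closure he
  rw [frameMatroid_completeGraph_closure] at hcl
  rcases spanned_of_mem_closure hcl (isLink_arc hij η 1) with h | h
  · exact H.arc_one_mem_closure_of_reach hI.subset h hij
  · refine absurd h.1 (not_unb_of_trivial (S := Set.univ) (η := fun x => (η x : Γ ⧸ Γ₁))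
      (fun f hf a b hab _ => ⟨trivial, ?_⟩) trivial)
    exact (mem_switchSet_quotient.2 (switchSet_mono bot_le (hI.subset hf))).2 a b hab

omit H in
theorem arc_mem_frameClosure_of_mem {i j : Fin n} (hij : i ≠ j) {η : Fin n → Γ} {g : Γ}
    (hg : g ∈ Γ₁) {X : Set (CompleteEdge n Γ)} (hX : arc hij η 1 ∈ X) :
    arc hij η g ∈ frameClosure ((completeGain n Γ).quotient Γ₁) X := by
  refine frameClosure_mono (Set.singleton_subset_iff.2 hX) (mem_frameClosure_quotient (η := η)
    ?_ (isLink_arc hij η g) (.single rfl (isLink_arc hij η 1)) ((arc_mem_switchSet hij).2 hg))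
  rw [Set.singleton_subset_iff, arc_mem_switchSet]
  exact one_mem _

/-- A spanned edge has gain in `Γ₁`, so it is spanned in `N` by the trivial edge parallel to it, but
not in `M`. The pair is then bad, and so would be the set of trivial edges that spans it. -/
theorem arc_notMem_closure_trivial {i j : Fin n} (hij : i ≠ j) (η : Fin n → Γ) {g : Γ}
    (hg : g ≠ 1) : arc hij η g ∉ M.closure (switchSet (completeGain n Γ) η ⊥) := by
  intro hcl
  have hg₁ : g ∈ Γ₁ :=
    (arc_mem_switchSet hij).1 (frameClosure_quotient_subset subset_rfl (H.mem_frameClosure hcl))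
  have hb : B {arc hij η g, arc hij η 1} := by
    refine H.lift.exchange ?_ (H.arc_notMem_closure_singleton hij η hg)
    rw [frameMatroid_completeGraph_closure]
    exact arc_mem_frameClosure_of_mem hij hg₁ rfl
  refine H.not_bad_trivial η (H.lift.bad_of_subset_closure hb (Set.insert_subset hcl ?_))
  exact Set.singleton_subset_iff.2 (H.subset_closure _ ((arc_mem_switchSet hij).2 (one_mem _)))

end IsCompleteLift

end Complete

theorem exists_fin_ne {n : ℕ} (hn : 4 ≤ n) (i j k : Fin n) :
    ∃ m : Fin n, m ≠ i ∧ m ≠ j ∧ m ≠ k := by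
  obtain ⟨m, hm⟩ := Finset.exists_mem_notMem_of_card_lt_card (s := {i, j, k})
    (t := Finset.univ) (lt_of_le_of_lt Finset.card_le_three (by simp; omega))
  exact ⟨m, by simpa using hm.2⟩

/-! ### The subgroups of gains spanned modulo the trivial edges -/

section Complete

variable {n : ℕ} {Γ : Type*} [Group Γ]

/-- The edges that after switching by `η` are trivial or have gain `g` in some direction. -/
def gainOrTrivial (η : Fin n → Γ) (g : Γ) : Set (CompleteEdge n Γ) :=
  {e | ∃ i j, ∃ h : i ≠ j, e = arc h η g} ∪ switchSet (completeGain n Γ) η ⊥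

variable {Γ₁ : Subgroup Γ} [Γ₁.Normal] {M : Matroid (CompleteEdge n Γ)}
  {B : Set (CompleteEdge n Γ) → Prop}

namespace IsCompleteLift

variable (H : IsCompleteLift Γ₁ M B)

include H

theorem change_right {i j k : Fin n} (hij : i ≠ j) (hik : i ≠ k) {η : Fin n → Γ} {g : Γ}
    {X : Set (CompleteEdge n Γ)} (hX : switchSet (completeGain n Γ) η ⊥ ⊆ X)
    (h : arc hij η g ∈ M.closure X) : arc hik η g ∈ M.closure X := by
  by_cases hjk : j = k
  · subst hjk; exact h
  · simpa using H.triangle_mem hij hjk hik h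
      (H.subset_closure X (hX ((arc_mem_switchSet hjk).2 (one_mem _))))

theorem change_left {i j k : Fin n} (hij : i ≠ j) (hkj : k ≠ j) {η : Fin n → Γ} {g : Γ}
    {X : Set (CompleteEdge n Γ)} (hX : switchSet (completeGain n Γ) η ⊥ ⊆ X)
    (h : arc hij η g ∈ M.closure X) : arc hkj η g ∈ M.closure X := by
  by_cases hik : k = i
  · subst hik; exact h
  · simpa using H.triangle_mem hik hij hkj
      (H.subset_closure X (hX ((arc_mem_switchSet hik).2 (one_mem _)))) h

/-- Modulo the trivial edges, all edges with the same gain are parallel. -/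
theorem arc_mem_closure_of_arc_mem (hn : 4 ≤ n) {i j k l : Fin n} (hij : i ≠ j) (hkl : k ≠ l)
    {η : Fin n → Γ} {g : Γ} {X : Set (CompleteEdge n Γ)}
    (hX : switchSet (completeGain n Γ) η ⊥ ⊆ X) (h : arc hij η g ∈ M.closure X) :
    arc hkl η g ∈ M.closure X := by
  obtain ⟨m, hmi, hmj, hml⟩ := exists_fin_ne hn i j l
  -- The edge moves from `i → j` to `m → j`, `m → l` and `k → l`; avoiding `i`, `j` and `l` at once
  -- keeps the ends distinct throughout.
  exact H.change_left hml hkl hX (H.change_right hmj hml hX (H.change_left hij hmj hX h))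

/-- The elements of `Γ` that label the edges of the flat spanned by the trivial edges and
the edges with gain `g`. -/
def gainClosure (hn : 4 ≤ n) (η : Fin n → Γ) (g : Γ) : Subgroup Γ where
  carrier := {x | ∀ i j, ∀ h : i ≠ j, arc h η x ∈ M.closure (gainOrTrivial η g)}
  one_mem' i j h := H.subset_closure _ (Or.inr ((arc_mem_switchSet h).2 (one_mem _)))
  mul_mem' := by
    intro a b ha hb i j h
    -- Products are composed through a third vertex by a balanced triangle.
    obtain ⟨m, hmi, hmj, -⟩ := exists_fin_ne hn i j j
    exact H.triangle_mem hmi.symm hmj h (ha i m hmi.symm) (hb m j hmj)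
  inv_mem' := by
    intro a ha i j h
    rw [← arc_symm, inv_inv]
    exact ha j i h.symm

theorem gainOrTrivial_subset (hn : 4 ≤ n) {i j : Fin n} (hij : i ≠ j) (η : Fin n → Γ) (g : Γ) :
    gainOrTrivial η g ⊆
      M.closure (insert (arc hij η g) (switchSet (completeGain n Γ) η ⊥)) := by
  rintro e (⟨k, l, hkl, rfl⟩ | he)
  · exact H.arc_mem_closure_of_arc_mem hn hij hkl (Set.subset_insert _ _)
      (H.subset_closure _ (Set.mem_insert _ _))
  · exact H.subset_closure _ (Or.inr he)

/-- Since edges of equal gain are parallel modulo the trivial edges, one edge of gain `g` spans them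
all, and one edge of gain `x` tests membership. -/
theorem mem_gainClosure_iff (hn : 4 ≤ n) {i j k l : Fin n} (hij : i ≠ j) (hkl : k ≠ l)
    {η : Fin n → Γ} {g x : Γ} : x ∈ H.gainClosure hn η g ↔
      arc hkl η x ∈ M.closure (insert (arc hij η g) (switchSet (completeGain n Γ) η ⊥)) := by
  constructor
  · intro h
    exact M.closure_subset_closure_of_subset_closure (H.gainOrTrivial_subset hn hij η g)
      (h k l hkl)
  · intro h a b hab
    refine H.arc_mem_closure_of_arc_mem hn hkl hab Set.subset_union_right
      (M.closure_subset_closure (Set.insert_subset ?_ Set.subset_union_right) h)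
    exact Or.inl ⟨i, j, hij, rfl⟩

theorem self_mem_gainClosure (hn : 4 ≤ n) (η : Fin n → Γ) (g : Γ) :
    g ∈ H.gainClosure hn η g :=
  fun i j h => H.subset_closure _ (Or.inl ⟨i, j, h, rfl⟩)

/-- This is closure exchange over the trivial edges, available because they do not span an edge of
gain `x ≠ 1`. -/
theorem mem_gainClosure_symm (hn : 4 ≤ n) {η : Fin n → Γ} {g x : Γ} (hx : x ≠ 1)
    (h : x ∈ H.gainClosure hn η g) : g ∈ H.gainClosure hn η x := by
  have h01 : (⟨0, by omega⟩ : Fin n) ≠ ⟨1, by omega⟩ := by simp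
  rw [H.mem_gainClosure_iff hn h01 h01] at h ⊢
  exact (M.closure_exchange ⟨h, H.arc_notMem_closure_trivial h01 η hx⟩).1

theorem gainClosure_le (hn : 4 ≤ n) {η : Fin n → Γ} {g x : Γ} (h : x ∈ H.gainClosure hn η g) :
    H.gainClosure hn η x ≤ H.gainClosure hn η g := by
  intro y hy i j hij
  refine M.closure_subset_closure_of_subset_closure ?_ (hy i j hij)
  rintro e (⟨k, l, hkl, rfl⟩ | he)
  · exact h k l hkl
  · exact H.subset_closure _ (Or.inr he)

theorem gainClosure_eq (hn : 4 ≤ n) {η : Fin n → Γ} {g x : Γ} (hx : x ≠ 1)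
    (h : x ∈ H.gainClosure hn η g) : H.gainClosure hn η x = H.gainClosure hn η g :=
  (H.gainClosure_le hn h).antisymm (H.gainClosure_le hn (H.mem_gainClosure_symm hn hx h))

/-- In `N` the trivial edges already span the edges with gain in `Γ₁`, and no others. -/
theorem gainClosure_le_of_mem (hn : 4 ≤ n) {η : Fin n → Γ} {g : Γ} (hg : g ∈ Γ₁) :
    H.gainClosure hn η g ≤ Γ₁ := by
  intro x hx
  have h01 : (⟨0, by omega⟩ : Fin n) ≠ ⟨1, by omega⟩ := by simp
  rw [H.mem_gainClosure_iff hn h01 h01] at hx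
  have h1 := H.mem_frameClosure hx
  refine (arc_mem_switchSet h01).1 (frameClosure_quotient_subset (η := η)
    (X := switchSet (completeGain n Γ) η ⊥) subset_rfl
    (frameClosure_idem (Set.insert_subset ?_ ?_) h1))
  · exact arc_mem_frameClosure_of_mem h01 hg ((arc_mem_switchSet h01).2 (one_mem _))
  · exact subset_frameClosure fun e _ => mem_completeGraph_edgeSet e

theorem eq_one_of_mem_gainClosure (hn : 4 ≤ n) {η : Fin n → Γ} {g x : Γ} (hg : g ∉ Γ₁)
    (hx : x ∈ H.gainClosure hn η g) (hx₁ : x ∈ Γ₁) : x = 1 := by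
  by_contra hne
  exact hg (H.gainClosure_le_of_mem hn hx₁ (H.mem_gainClosure_symm hn hne hx))

/-- An `N`-basis of the trivial edges together with one edge of gain `g ∉ Γ₁` is independent in `N`,
and it spans the whole set in `M`. Badness would pass to it. -/
theorem not_bad_gainClosure (hn : 4 ≤ n) {η : Fin n → Γ} {g : Γ} (hg : g ∉ Γ₁) :
    ¬ B (switchSet (completeGain n Γ) η (H.gainClosure hn η g)) := by
  intro hb
  have h01 : (⟨0, by omega⟩ : Fin n) ≠ ⟨1, by omega⟩ := by simp
  set N := frameMatroid ((completeGain n Γ).quotient Γ₁)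
  set T := switchSet (completeGain n Γ) η ⊥
  obtain ⟨I, hI⟩ := N.exists_isBasis T (fun e _ => mem_completeGraph_edgeSet e)
  have hMI := H.lift.isBasis_of_not_bad hI (H.not_bad_trivial η)
  have hind : N.Indep (insert (arc h01 η g) I) := by
    rw [Matroid.insert_indep_iff]
    refine ⟨hI.indep, fun _ => ⟨mem_completeGraph_edgeSet _, fun hf => hg ?_⟩⟩
    rw [frameMatroid_completeGraph_closure] at hf
    exact (arc_mem_switchSet h01).1 (frameClosure_quotient_subset hI.subset hf)
  refine H.lift.not_bad hind (H.lift.bad_of_subset_closure hb fun e he => ?_)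
  obtain ⟨i, j, hij, x, hx, rfl⟩ := mem_switchSet_iff_exists_arc.1 he
  refine M.closure_subset_closure_of_subset_closure (Set.insert_subset ?_ ?_)
    ((H.mem_gainClosure_iff hn h01 hij).1 hx)
  · exact H.subset_closure _ (Set.mem_insert _ _)
  · exact hMI.subset_closure.trans (M.closure_subset_closure (Set.subset_insert _ _))

/-! ### Independence of the switching function, conjugation and malnormality -/

omit H in
theorem unb_of_arc_mem {i j : Fin n} (hij : i ≠ j) {η : Fin n → Γ} {g : Γ} (hg : g ∉ Γ₁)
    {X : Set (CompleteEdge n Γ)} (h₁ : arc hij η 1 ∈ X) (h₂ : arc hij η g ∈ X) :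
    Unb ((completeGain n Γ).quotient Γ₁) X i := by
  refine Unb.of_ne (.single h₁ (isLink_arc hij η 1)) (.single h₂ (isLink_arc hij η g)) fun h => ?_
  refine hg ((arc_mem_switchSet hij (η := η)).1 (mem_switchSet_of_isLink (isLink_arc hij η g) ?_))
  have h' : ((((completeGain n Γ).val (arc hij η 1) i j : Γ)) : Γ ⧸ Γ₁) =
    ((completeGain n Γ).val (arc hij η g) i j : Γ) := h
  rw [val_arc, val_arc] at h'
  rw [switch_val_arc]
  rw [← QuotientGroup.eq_one_iff]
  simpa using h'.symm

/-- The local form of membership. The edges of gains `1` and `g` between `i` and `j` unbalance `i`,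
so the three edges span the fourth in `N`. If they did not in `M`, the four edges would be bad,
although they lie in a set that is not bad. The vertices `j` and `k` may coincide. -/
theorem arc_mem_closure_of_mem_gainClosure (hn : 4 ≤ n) {i j k : Fin n} (hij : i ≠ j)
    (hik : i ≠ k) {η : Fin n → Γ} {g x : Γ} (hg : g ∉ Γ₁) (hx : x ∈ H.gainClosure hn η g) :
    arc hik η x ∈ M.closure {arc hij η 1, arc hik η 1, arc hij η g} := by
  by_contra hcl
  have hu : Unb ((completeGain n Γ).quotient Γ₁) {arc hij η 1, arc hik η 1, arc hij η g} i :=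
    unb_of_arc_mem hij (η := η) hg (by simp) (by simp)
  have hb := H.lift.exchange (f := arc hik η x) (X := {arc hij η 1, arc hik η 1, arc hij η g})
    (by
      rw [frameMatroid_completeGraph_closure]
      exact ⟨i, k, isLink_arc hik η x, Or.inr ⟨hu, hu.trans (.single (e := arc hik η 1) (by simp)
        (isLink_arc hik η 1))⟩⟩) hcl
  refine H.not_bad_gainClosure hn hg (η := η) (H.lift.mono ?_ hb)
  rintro e (rfl | rfl | rfl | rfl)
  · exact (arc_mem_switchSet hik).2 hx
  · exact (arc_mem_switchSet hij).2 (one_mem _)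
  · exact (arc_mem_switchSet hik).2 (one_mem _)
  · exact (arc_mem_switchSet hij).2 (H.self_mem_gainClosure hn η g)

theorem gainClosure_le_of_agree (hn : 4 ≤ n) {i j k : Fin n} (hij : i ≠ j) (hik : i ≠ k)
    {η η' : Fin n → Γ} (hi : η i = η' i) (hj : η j = η' j) (hk : η k = η' k)
    {g : Γ} (hg : g ∉ Γ₁) : H.gainClosure hn η g ≤ H.gainClosure hn η' g := by
  intro x hx
  have aux : ∀ y, arc hij η y = arc hij η' y ∧ arc hik η y = arc hik η' y := fun y =>
    ⟨arc_eq_arc _ (by rw [hi, hj]), arc_eq_arc _ (by rw [hi, hk])⟩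
  have h := H.arc_mem_closure_of_mem_gainClosure hn hij hik hg hx
  rw [(aux x).2, (aux 1).1, (aux 1).2, (aux g).1] at h
  refine (H.mem_gainClosure_iff hn hij hik).2 (M.closure_subset_closure ?_ h)
  rintro e (rfl | rfl | rfl)
  · exact Or.inr ((arc_mem_switchSet hij).2 (one_mem _))
  · exact Or.inr ((arc_mem_switchSet hik).2 (one_mem _))
  · exact Or.inl rfl

/-- The switching function is changed at one vertex `a` at a time; the local form of membership at
vertices other than `a` does not see the change. -/
theorem gainClosure_le_of_switch (hn : 4 ≤ n) {g : Γ} (hg : g ∉ Γ₁) (s : Finset (Fin n)) :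
    ∀ η η' : Fin n → Γ, (∀ x ∉ s, η x = η' x) →
      H.gainClosure hn η g ≤ H.gainClosure hn η' g := by
  classical
  induction s using Finset.induction_on with
  | empty =>
    intro η η' h
    rw [funext fun x => h x (by simp)]
  | insert a s _ ih =>
    intro η η' h
    obtain ⟨i, hi, -⟩ := exists_fin_ne hn a a a
    -- Only `j ≠ i` and `k ≠ i` are needed, so `j` and `k` are not required to differ.
    obtain ⟨j, hj, hji, -⟩ := exists_fin_ne hn a i i
    obtain ⟨k, hk, hki, -⟩ := exists_fin_ne hn a i i
    refine (H.gainClosure_le_of_agree hn hji.symm hki.symm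
      (η' := Function.update η a (η' a)) ?_ ?_ ?_ hg).trans (ih _ _ fun x hx => ?_)
    · rw [Function.update_of_ne hi]
    · rw [Function.update_of_ne hj]
    · rw [Function.update_of_ne hk]
    · by_cases hxa : x = a
      · subst hxa; simp
      · rw [Function.update_of_ne hxa]
        exact h x (by simp [hxa, hx])

theorem gainClosure_switch (hn : 4 ≤ n) {g : Γ} (hg : g ∉ Γ₁) (η η' : Fin n → Γ) :
    H.gainClosure hn η g = H.gainClosure hn η' g :=
  (H.gainClosure_le_of_switch hn hg Finset.univ η η' (by simp)).antisymm
    (H.gainClosure_le_of_switch hn hg Finset.univ η' η (by simp))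

/-- Switching by the constant `s` conjugates all gains by `s` and preserves the trivial edges, while
the subgroup of `g` is unchanged. -/
theorem conj_mem_gainClosure (hn : 4 ≤ n) {g x : Γ} (hg : g ∉ Γ₁) (s : Γ)
    (hx : x ∈ H.gainClosure hn 1 g) : s * x * s⁻¹ ∈ H.gainClosure hn 1 (s * g * s⁻¹) := by
  have h01 : (⟨0, by omega⟩ : Fin n) ≠ ⟨1, by omega⟩ := by simp
  have aux : ∀ {i j : Fin n} (h : i ≠ j) (y : Γ),
      arc h (fun _ => s) y = arc h 1 (s * y * s⁻¹) := fun h y => arc_eq_arc h (by simp)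
  rw [H.gainClosure_switch hn hg 1 fun _ => s, H.mem_gainClosure_iff hn h01 h01, aux, aux] at hx
  refine (H.mem_gainClosure_iff hn h01 h01).2 (M.closure_subset_closure
    (Set.insert_subset_insert ?_) hx)
  intro e he
  obtain ⟨i, j, hij, y, hy, rfl⟩ := mem_switchSet_iff_exists_arc.1 he
  obtain rfl := Subgroup.mem_bot.1 hy
  rw [aux, arc_mem_switchSet]
  simp

/-- If `b` and its conjugate by `g` lie in the same gain closure, then so does `g`. -/
theorem mem_gainClosure_of_conj_mem (hn : 4 ≤ n) {b g : Γ} (hb : b ∉ Γ₁)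
    (hc : g⁻¹ * b * g ∈ H.gainClosure hn 1 b) : g ∈ H.gainClosure hn 1 b := by
  classical
  have hc₁ : g⁻¹ * b * g ∉ Γ₁ := fun h => hb (by
    have := (inferInstance : Γ₁.Normal).conj_mem _ h g
    simpa [mul_assoc] using this)
  obtain ⟨p, -⟩ : ∃ p : Fin n, True := ⟨⟨0, by omega⟩, trivial⟩
  obtain ⟨q, hqp, -⟩ := exists_fin_ne hn p p p
  obtain ⟨r, hrp, hrq, -⟩ := exists_fin_ne hn p q q
  obtain ⟨t, htp, htq, htr⟩ := exists_fin_ne hn p q r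
  set c := g⁻¹ * b * g
  -- `Y` consists of the edges `p → t` of gains `1` and `b` and the edge `q → r` of gain `1`. Adding
  -- `p → r` of gain `g` will span `q → r` of gain `c`, which `Y` alone does not; exchange then
  -- recovers `p → r` of gain `g` from `Y` and `q → r` of gain `c`.
  set Y : Set (CompleteEdge n Γ) :=
    {arc htp.symm 1 1, arc htp.symm 1 b, arc hrq.symm 1 1}
  -- After switching `r` by `g⁻¹`, the edges `p → r` of gains `g` and `b * g` have gains `1` and
  -- `b`, and the local form at `p` applies.
  have hA : arc hrp.symm 1 (b * g) ∈ M.closure (insert (arc hrp.symm 1 g) Y) := by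
    have h := H.arc_mem_closure_of_mem_gainClosure hn htp.symm hrp.symm
      (η := Function.update 1 r g⁻¹) hb (H.self_mem_gainClosure hn _ b)
    have aux : ∀ y, arc htp.symm (Function.update 1 r g⁻¹) y = arc htp.symm 1 y := fun y =>
      arc_eq_arc _ (by simp [Function.update_of_ne hrp.symm, Function.update_of_ne htr])
    have aux' : ∀ y, arc hrp.symm (Function.update 1 r g⁻¹) y = arc hrp.symm 1 (y * g) :=
      fun y => arc_eq_arc _ (by simp [Function.update_of_ne hrp.symm])
    rw [aux, aux, aux', aux', one_mul] at h
    refine M.closure_subset_closure ?_ h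
    rintro e (rfl | rfl | rfl) <;> simp [Y]
  -- After switching `p` by `g`, the edges `r → p` opposite to `p → r` of gains `g` and `b * g = g *
  -- c` have gains `1` and `c⁻¹`, and the local form at `r` applies.
  have hB : arc hrq.symm 1 c ∈ M.closure {arc hrp.symm 1 g, arc hrq.symm 1 1,
      arc hrp.symm 1 (b * g)} := by
    have h := H.arc_mem_closure_of_mem_gainClosure hn hrp hrq
      (η := Function.update 1 p g) (fun h => hc₁ (by simpa using Γ₁.inv_mem h))
      (H.self_mem_gainClosure hn _ c⁻¹)
    have aux : ∀ y, arc hrq (Function.update 1 p g) y = arc hrq.symm 1 y⁻¹ := fun y => by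
      rw [← arc_symm]
      exact arc_eq_arc _ (by simp [Function.update_of_ne hrp, Function.update_of_ne hqp])
    have aux' : ∀ y, arc hrp (Function.update 1 p g) y = arc hrp.symm 1 (g * y⁻¹) := fun y => by
      rw [← arc_symm]
      exact arc_eq_arc _ (by simp [Function.update_of_ne hrp])
    rw [aux, aux, aux', aux'] at h
    simpa [c, mul_assoc] using h
  have hin : arc hrq.symm 1 c ∈ M.closure (insert (arc hrp.symm 1 g) Y) := by
    refine M.closure_subset_closure_of_subset_closure ?_ hB
    rintro e (rfl | rfl | rfl)
    · exact H.subset_closure _ (Or.inl rfl)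
    · exact H.subset_closure _ (by simp [Y])
    · exact hA
  -- The component `{q, r}` of `Y` has a single edge, so it is balanced in `N` and spans only edges
  -- with gain in `Γ₁` there.
  have hout : arc hrq.symm 1 c ∉ M.closure Y := by
    intro h
    have h1 := eq_one_of_mem_frameClosure (S := {q, r}) (η := 1) ?_ (isLink_arc hrq.symm 1 c)
      (by simp) (H.mem_frameClosure h)
    · have h2 : (((completeGain n Γ).switch 1).val (arc hrq.symm 1 c) q r : Γ ⧸ Γ₁) = 1 := h1.2
      rw [switch_val_arc, QuotientGroup.eq_one_iff] at h2
      exact hc₁ h2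
    · have key : ∀ y, ∀ u v, (completeGraph n Γ).IsLink (arc htp.symm 1 y) u v →
          u ∉ ({q, r} : Set (Fin n)) := by
        intro y u v hl
        rcases (isLink_arc htp.symm 1 y).eq_and_eq_or_eq_and_eq hl with ⟨rfl, rfl⟩ | ⟨rfl, rfl⟩
        · simp [hqp.symm, hrp.symm]
        · simp [htq, htr]
      rintro e (rfl | rfl | rfl) u v hl hu
      · exact absurd hu (key _ u v hl)
      · exact absurd hu (key _ u v hl)
      · refine ⟨?_, ?_⟩
        · rcases (isLink_arc hrq.symm 1 1).eq_and_eq_or_eq_and_eq hl with ⟨rfl, rfl⟩ | ⟨rfl, rfl⟩ <;>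
            simp
        · have h3 := (mem_switchSet_quotient (Γ₁ := Γ₁)).2
            ((arc_mem_switchSet hrq.symm (η := 1) (A := Γ₁)).2 (one_mem _))
          exact h3.2 u v hl
  refine (H.mem_gainClosure_iff hn htp.symm hrp.symm).2
    (M.closure_subset_closure_of_subset_closure ?_ (M.closure_exchange ⟨hin, hout⟩).1)
  rintro e (rfl | rfl | rfl | rfl)
  · exact (H.mem_gainClosure_iff hn htp.symm hrq.symm).1 hc
  · exact H.subset_closure _ (Or.inr ((arc_mem_switchSet _).2 (one_mem _)))
  · exact H.subset_closure _ (Or.inl rfl)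
  · exact H.subset_closure _ (Or.inr ((arc_mem_switchSet _).2 (one_mem _)))

/-! ### The Frobenius partition and its linear class -/

theorem isFrobeniusPartition (hn : 4 ≤ n) :
    IsFrobeniusPartition Γ₁ {A | ∃ g ∉ Γ₁, A = H.gainClosure hn 1 g} where
  normal := inferInstance
  nontrivial := by
    rintro _ ⟨g, hg, rfl⟩ h
    have := H.self_mem_gainClosure hn 1 g
    rw [h, Subgroup.mem_bot] at this
    exact hg (this ▸ one_mem _)
  partition := by
    intro g hg
    by_cases hg₁ : g ∈ Γ₁
    · refine ⟨Γ₁, ⟨Or.inl rfl, hg₁⟩, ?_⟩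
      rintro _ ⟨rfl | ⟨a, ha, rfl⟩, h⟩
      · rfl
      · exact absurd (H.eq_one_of_mem_gainClosure hn ha h hg₁) hg
    · refine ⟨H.gainClosure hn 1 g, ⟨Or.inr ⟨g, hg₁, rfl⟩, H.self_mem_gainClosure hn 1 g⟩, ?_⟩
      rintro _ ⟨rfl | ⟨a, ha, rfl⟩, h⟩
      · exact absurd h hg₁
      · exact (H.gainClosure_eq hn hg h).symm
  malnormal := by
    rintro _ ⟨a, ha, rfl⟩ g hg b hb hc
    by_contra hb1
    have hb₁ : b ∉ Γ₁ := fun h => hb1 (H.eq_one_of_mem_gainClosure hn ha hb h)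
    -- The subgroup is also the one generated in this sense by its nontrivial element `b`, the form
    -- needed for `mem_gainClosure_of_conj_mem`.
    rw [← H.gainClosure_eq hn hb1 hb] at hg hc
    exact hg (H.mem_gainClosure_of_conj_mem hn hb₁ hc)
  conj_mem := by
    rintro _ ⟨a, ha, rfl⟩ g
    have hconj : ∀ x s, x ∉ Γ₁ → s * x * s⁻¹ ∉ Γ₁ := fun x s hx h => hx (by
      have := (inferInstance : Γ₁.Normal).conj_mem _ h s⁻¹
      simpa [mul_assoc] using this)
    refine ⟨g * a * g⁻¹, hconj a g ha, ?_⟩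
    ext x
    simp only [Subgroup.mem_map, MulEquiv.coe_toMonoidHom, MulAut.conj_apply]
    constructor
    · rintro ⟨y, hy, rfl⟩
      exact H.conj_mem_gainClosure hn ha g hy
    · intro hx
      -- The reverse inclusion is the forward one for conjugation by `g⁻¹`.
      refine ⟨g⁻¹ * x * g, ?_, by group⟩
      have := H.conj_mem_gainClosure hn (hconj a g ha) g⁻¹ hx
      simpa [mul_assoc] using this

/-- Among circuits of `N`, not being bad is being a circuit of `M`. For cycles this is balance by
hypothesis; thetas and handcuffs are settled by `not_bad_gainClosure` in one direction and by the
two nontrivial edges left after switching in the other. -/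
theorem gainClass_eq (hn : 4 ≤ n) :
    gainClass Γ₁ {A | ∃ g ∉ Γ₁, A = H.gainClosure hn 1 g} (completeGain n Γ) =
      {C | (frameMatroid ((completeGain n Γ).quotient Γ₁)).IsCircuit C ∧ ¬ B C} := by
  ext C
  refine and_congr_right fun hC => ?_
  rw [← H.lift.isCircuit_iff_not_bad hC]
  constructor
  · rintro (⟨W, h⟩ | ⟨-, η, _, ⟨g, hg, rfl⟩, h⟩)
    · exact (H.isCircuit_iff C W 1 h).2 ⟨W, h⟩
    · rw [H.lift.isCircuit_iff_not_bad hC]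
      refine fun hb => H.not_bad_gainClosure hn hg (η := η) (H.lift.mono (fun e he => ?_) hb)
      rw [H.gainClosure_switch hn hg η 1]
      exact ⟨mem_completeGraph_edgeSet e, h e he⟩
  · intro hM
    rcases isFrameCircuit_of_isCircuit hC with ⟨W, h⟩ | h
    · obtain ⟨k, hk⟩ := h.of_quotient
      exact Or.inl ((H.isCircuit_iff C W k hk).1 hM)
    · refine Or.inr ⟨h, ?_⟩
      obtain ⟨η, R, f₁, f₂, rfl, hf, hR, h₁, h₂⟩ := exists_switch_of_isCircuit hC h
      -- Taking `A = ⊤` puts no condition on the gain; it only writes the edge as an `arc`.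
      obtain ⟨i, j, hij, g, -, rfl⟩ := mem_switchSet_iff_exists_arc (A := ⊤) (η := η).1
        (show f₁ ∈ _ from ⟨mem_completeGraph_edgeSet _, by simp⟩)
      obtain ⟨k, l, hkl, g', -, rfl⟩ := mem_switchSet_iff_exists_arc (A := ⊤) (η := η).1
        (show f₂ ∈ _ from ⟨mem_completeGraph_edgeSet _, by simp⟩)
      rw [arc_mem_switchSet] at h₁ h₂
      -- In the circuit of `M`, the first special edge is spanned by the second and trivial edges.
      have hmem : g ∈ H.gainClosure hn η g' := by
        refine (H.mem_gainClosure_iff hn hkl hij).2 (M.closure_subset_closure ?_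
          (hM.mem_closure_sdiff_singleton_of_mem (Set.mem_insert _ _)))
        rw [Set.insert_sdiff_self_of_notMem hf]
        exact Set.insert_subset_insert hR
      refine ⟨η, _, ⟨g', h₂, rfl⟩, ?_⟩
      rw [H.gainClosure_switch hn h₂ 1 η]
      have hsub : insert (arc hij η g) (insert (arc hkl η g') R) ⊆
          switchSet (completeGain n Γ) η (H.gainClosure hn η g') :=
        Set.insert_subset ((arc_mem_switchSet hij).2 hmem) (Set.insert_subset
          ((arc_mem_switchSet hkl).2 (H.self_mem_gainClosure hn η g'))
          (hR.trans (switchSet_mono bot_le)))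
      exact fun e he => (hsub he).2

end IsCompleteLift

end Complete

end GainGraph

theorem theorem2 {Γ : Type*} [Group Γ] [Finite Γ] (Γ₁ : Subgroup Γ) [Γ₁.Normal]
    (n : ℕ) (hn : 4 ≤ n) (M : Matroid (GainGraph.CompleteEdge n Γ))
    (hM : GainGraph.IsElementaryLift M
      (GainGraph.frameMatroid ((GainGraph.completeGain n Γ).quotient Γ₁)))
    (hC : ∀ C W g, GainGraph.IsCycle (GainGraph.completeGain n Γ) C W g →
      (M.IsCircuit C ↔ GainGraph.IsBalancedCycle (GainGraph.completeGain n Γ) C)) :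
    ∃ 𝒜 : Set (Subgroup Γ), GainGraph.IsFrobeniusPartition Γ₁ 𝒜 ∧
      GainGraph.IsGainLift M Γ₁ 𝒜 (GainGraph.completeGain n Γ) := by
  obtain ⟨B, hB⟩ := hM.exists_liftFamily
  have H : GainGraph.IsCompleteLift Γ₁ M B := ⟨hB, hC⟩
  refine ⟨_, H.isFrobeniusPartition hn, ?_⟩
  -- Finiteness of `Γ` makes the edge set finite, as the rank count in `LiftFamily.isLinearClass`
  -- requires.
  have : (GainGraph.frameMatroid ((GainGraph.completeGain n Γ).quotient Γ₁)).Finite :=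
    ⟨Set.toFinite _⟩
  rw [GainGraph.IsGainLift, H.gainClass_eq hn]
  exact hB.isLiftOfClass
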